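/- Let $f(x,y)=\frac1n\sum_{i=1}^n f_i(x,y)$ with $n\ge 1$, $x\in\mathbb R^{d_1}$, $y\in\mathbb R^{d_2}$, where each $f_i$ is continuously differentiable with $l$-Lipschitz gradients, $l>0$: $\|\nabla_x f_i(x_1,y_1)-\nabla_x f_i(x_2,y_2)\|\le l(\|x_1-x_2\|+\|y_1-y_2\|)$ for all $x_1,x_2,y_1,y_2$, and likewise for $\nabla_y f_i$. Assume that $f$ has a saddle point, that $\min_x f(x,y)$ is attained for every $y$ and $\max_y f(x,y)$ is attained for every $x$, and that $f$ satisfies the two-sided PL condition with constants $\mu_1,\mu_2>0$: for all $x,y$, $$\|\nabla_x f(x,y)\|^2\ge 2\mu_1\bigl[f(x,y)-\min_{x'}f(x',y)\bigr],\qquad \|\nabla_y f(x,y)\|^2\ge 2\mu_2\bigl[\max_{y'}f(x,y')-f(x,y)\bigr].$$ Put $\kappa=l/\min(\mu_1,\mu_2)$, $g(x)=\max_y f(x,y)$, $g^*=\min_x g(x)$, and assume $n\le\kappa^9$. VR-AGDA with stepsizes $\tau_1,\tau_2$ and iteration numbers $N,T$ starts from any point $(x^0,y^0)$ and computes $(x^{k+1},y^{k+1})$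 from $(x^k,y^k)$ in one epoch. Set $(\tilde x_0,\tilde y_0)=(x^k,y^k)$. For $t=0,\dots,T-1$: set $(x_{t,0},y_{t,0})=(\tilde x_t,\tilde y_t)$, compute the full gradients $\nabla_xf(\tilde x_t,\tilde y_t)$ and $\nabla_yf(\tilde x_t,\tilde y_t)$ from all $n$ components; for $j=0,\dots,N-1$ draw $i^1,i^2$ independently and uniformly from $\{1,\dots,n\}$ and put $$x_{t,j+1}=x_{t,j}-\tau_1\bigl[\nabla_xf_{i^1}(x_{t,j},y_{t,j})-\nabla_xf_{i^1}(\tilde x_t,\tilde y_t)+\nabla_xf(\tilde x_t,\tilde y_t)\bigr],$$ $$y_{t,j+1}=y_{t,j}+\tau_2\bigl[\nabla_yf_{i^2}(x_{t,j+1},y_{t,j})-\nabla_yf_{i^2}(\tilde x_t,\tilde y_t)+\nabla_yf(\tilde x_t,\tilde y_t)\bigr];$$ then set $(\tilde x_{t+1},\tilde y_{t+1})=(x_{t,N},y_{t,N})$. Finally $(x^{k+1},y^{k+1})$ is chosen uniformly at random from the $NT$ points $(x_{t,j},y_{t,j})$, $0\le t<T$, $0\le j<N$. All random choices are independent. Let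 $$P_k=\mathbb E[g(x^k)-g^*]+\tfrac1{20}\,\mathbb E[g(x^k)-f(x^k,y^k)].$$ There are absolute constants $\alpha,\beta,C>0$ (independent of $n,l,\mu_1,\mu_2,d_1,d_2$, of the $f_i$ and of the starting point) such that, for all such problems, with $$\tau_1=\frac{\beta}{28\kappa^2 l\,n^{2/3}},\quad \tau_2=\frac{\beta}{l\,n^{2/3}},\quad N=\Bigl\lfloor \alpha\beta^{-2/3}n\bigl(2+4\beta^{1/2}n^{-1/3}\bigr)^{-1}\Bigr\rfloor,\quad T=\lceil\kappa^3n^{-1/3}\rceil,$$ one has $N,T\ge1$, the expectations above exist, and $P_{k+1}\le\frac12P_k$ for every $k\ge0$. Moreover, for every $0<\varepsilon\le\frac12$ there is a $K$ such that $P_k\le\varepsilon$ for all $k\ge K$ and the total number of evaluations of component gradients $\nabla_xf_i$, $\nabla_yf_i$ in the first $K$ epochs is at most $$C\,n^{2/3}\kappa^3\bigl(\log(1/\varepsilon)+\max\{0,\log P_0\}\bigr)\quad(\text{with }\max\{0,\log P_0\}=0\text{ if }P_0=0);$$ that is, the total complexity to reach an $\varepsilon$-optimal solution is $O(n^{2/3}\kappa^3\log(1/\varepsilon))$.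 -/

import Mathlib

namespace VRAGDA

/-! ### Finite-sum minimax problems on `ℝ^{d₁} × ℝ^{d₂}` -/

/-- `ℝ^d` with the Euclidean norm. -/
abbrev Vec (d : ℕ) : Type := EuclideanSpace ℝ (Fin d)

section Problem

variable {d₁ d₂ : ℕ}

/-- The partial gradient `∇_x f (x, y)`. -/
noncomputable def gradX (f : Vec d₁ → Vec d₂ → ℝ) (x : Vec d₁) (y : Vec d₂) : Vec d₁ :=
  gradient (fun x' => f x' y) x

/-- The partial gradient `∇_y f (x, y)`. -/
noncomputable def gradY (f : Vec d₁ → Vec d₂ → ℝ) (x : Vec d₁) (y : Vec d₂) : Vec d₂ :=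
  gradient (fun y' => f x y') y

/-- `f` is continuously differentiable with `l`-Lipschitz partial gradients. -/
structure HasLipschitzGradients (f : Vec d₁ → Vec d₂ → ℝ) (l : ℝ) : Prop where
  contDiff : ContDiff ℝ 1 (fun z : Vec d₁ × Vec d₂ => f z.1 z.2)
  lipschitz_x : ∀ x₁ x₂ y₁ y₂,
    ‖gradX f x₁ y₁ - gradX f x₂ y₂‖ ≤ l * (‖x₁ - x₂‖ + ‖y₁ - y₂‖)
  lipschitz_y : ∀ x₁ x₂ y₁ y₂,
    ‖gradY f x₁ y₁ - gradY f x₂ y₂‖ ≤ l * (‖x₁ - x₂‖ + ‖y₁ - y₂‖)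

/-- `(x₀, y₀)` is a saddle point of `f`. -/
def IsSaddlePoint (f : Vec d₁ → Vec d₂ → ℝ) (x₀ : Vec d₁) (y₀ : Vec d₂) : Prop :=
  ∀ x y, f x₀ y ≤ f x₀ y₀ ∧ f x₀ y₀ ≤ f x y₀

/-- A saddle point exists, every `f (·, y)` attains its minimum and every `f (x, ·)` attains
its maximum. -/
structure HasOptima (f : Vec d₁ → Vec d₂ → ℝ) : Prop where
  exists_saddle : ∃ x₀ y₀, IsSaddlePoint f x₀ y₀
  exists_min : ∀ y, ∃ x₀, ∀ x, f x₀ y ≤ f x y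
  exists_max : ∀ x, ∃ y₀, ∀ y, f x y ≤ f x y₀

/-- The two-sided Polyak–Łojasiewicz condition. The infimum and the supremum are only used
together with `HasOptima`, where they are a minimum and a maximum. -/
structure TwoSidedPL (f : Vec d₁ → Vec d₂ → ℝ) (μ₁ μ₂ : ℝ) : Prop where
  pl_x : ∀ x y, 2 * μ₁ * (f x y - ⨅ x', f x' y) ≤ ‖gradX f x y‖ ^ 2
  pl_y : ∀ x y, 2 * μ₂ * ((⨆ y', f x y') - f x y) ≤ ‖gradY f x y‖ ^ 2

/-- The objective `f = (1/n) ∑ᵢ fᵢ`. -/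
noncomputable def average {n : ℕ} (f : Fin n → Vec d₁ → Vec d₂ → ℝ) :
    Vec d₁ → Vec d₂ → ℝ :=
  fun x y => (1 / (n : ℝ)) * ∑ i, f i x y

/-- The primal function `g x = max_y f (x, y)`. -/
noncomputable def primal (f : Vec d₁ → Vec d₂ → ℝ) (x : Vec d₁) : ℝ := ⨆ y, f x y

/-- The optimal value `g* = min_x g x`. -/
noncomputable def primalValue (f : Vec d₁ → Vec d₂ → ℝ) : ℝ := ⨅ x, primal f x

end Problem

/-! ### Computations with an oracle counter -/

/-- A result together with the number of oracle calls that were spent on it. -/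
structure Counted (α : Type) where
  val : α
  calls : ℕ

instance : Monad Counted where
  pure a := ⟨a, 0⟩
  bind c k := ⟨(k c.val).val, c.calls + (k c.val).calls⟩

/-- Carry out `n` computations and add up their results. -/
def Counted.sum {α : Type} [AddCommMonoid α] {n : ℕ} (c : Fin n → Counted α) : Counted α :=
  ⟨∑ i, (c i).val, ∑ i, (c i).calls⟩

/-! ### The algorithm -/

section Algorithm

variable {d₁ d₂ n N T : ℕ}

/-- One oracle call: evaluate `∇_x fᵢ (x, y)`. -/
noncomputable def oracleX (f : Fin n → Vec d₁ → Vec d₂ → ℝ) (i : Fin n)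
    (x : Vec d₁) (y : Vec d₂) : Counted (Vec d₁) := ⟨gradX (f i) x y, 1⟩

/-- One oracle call: evaluate `∇_y fᵢ (x, y)`. -/
noncomputable def oracleY (f : Fin n → Vec d₁ → Vec d₂ → ℝ) (i : Fin n)
    (x : Vec d₁) (y : Vec d₂) : Counted (Vec d₂) := ⟨gradY (f i) x y, 1⟩

/-- The full gradients `(1/n) ∑ᵢ ∇_x fᵢ` and `(1/n) ∑ᵢ ∇_y fᵢ` at the snapshot. -/
noncomputable def fullGradient (f : Fin n → Vec d₁ → Vec d₂ → ℝ) (snap : Vec d₁ × Vec d₂) :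
    Counted (Vec d₁ × Vec d₂) := do
  let u ← Counted.sum (fun i => oracleX f i snap.1 snap.2)
  let v ← Counted.sum (fun i => oracleY f i snap.1 snap.2)
  pure ((1 / (n : ℝ)) • u, (1 / (n : ℝ)) • v)

/-- One inner step from `z = (x_{t,j}, y_{t,j})` with the indices `(i¹, i²) = i`: first the
descent step in `x`, then the ascent step in `y` at the new `x`. -/
noncomputable def innerStep (f : Fin n → Vec d₁ → Vec d₂ → ℝ) (τ₁ τ₂ : ℝ)
    (snap full : Vec d₁ × Vec d₂) (i : Fin n × Fin n) (z : Vec d₁ × Vec d₂) :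
    Counted (Vec d₁ × Vec d₂) := do
  let u ← oracleX f i.1 z.1 z.2
  let u₀ ← oracleX f i.1 snap.1 snap.2
  let x := z.1 - τ₁ • (u - u₀ + full.1)
  let v ← oracleY f i.2 x z.2
  let v₀ ← oracleY f i.2 snap.1 snap.2
  let y := z.2 + τ₂ • (v - v₀ + full.2)
  pure (x, y)

/-- The inner loop: the point after `j ≤ N` inner steps from the snapshot. -/
noncomputable def innerLoop (f : Fin n → Vec d₁ → Vec d₂ → ℝ) (τ₁ τ₂ : ℝ)
    (snap full : Vec d₁ × Vec d₂) (s : Fin N → Fin n × Fin n) :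
    (j : ℕ) → j ≤ N → Counted (Vec d₁ × Vec d₂)
  | 0, _ => pure snap
  | j + 1, h => do
      let z ← innerLoop f τ₁ τ₂ snap full s j (Nat.le_of_succ_le h)
      innerStep f τ₁ τ₂ snap full (s ⟨j, h⟩) z

/-- The outer loop: the snapshot after `t ≤ T` passes, started at `z₀`. Each pass computes the
full gradients at its snapshot and performs `N` inner steps. -/
noncomputable def outerLoop (f : Fin n → Vec d₁ → Vec d₂ → ℝ) (τ₁ τ₂ : ℝ)
    (s : Fin T → Fin N → Fin n × Fin n) (z₀ : Vec d₁ × Vec d₂) :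
    (t : ℕ) → t ≤ T → Counted (Vec d₁ × Vec d₂)
  | 0, _ => pure z₀
  | t + 1, h => do
      let snap ← outerLoop f τ₁ τ₂ s z₀ t (Nat.le_of_succ_le h)
      let full ← fullGradient f snap
      innerLoop f τ₁ τ₂ snap full (s ⟨t, h⟩) N le_rfl

/-- The iterate `(x_{t,j}, y_{t,j})` of an epoch started at `z₀`. -/
noncomputable def iterate (f : Fin n → Vec d₁ → Vec d₂ → ℝ) (τ₁ τ₂ : ℝ)
    (s : Fin T → Fin N → Fin n × Fin n) (z₀ : Vec d₁ × Vec d₂) (t : Fin T) (j : Fin N) :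
    Vec d₁ × Vec d₂ :=
  let snap := (outerLoop f τ₁ τ₂ s z₀ t t.is_lt.le).val
  (innerLoop f τ₁ τ₂ snap (fullGradient f snap).val (s t) j j.is_lt.le).val

/-- All random choices of one epoch: the pair of indices `(i¹, i²)` for every inner step
`(t, j)`, and the position `(t, j)` of the iterate that the epoch returns. -/
abbrev Seed (n N T : ℕ) : Type := (Fin T → Fin N → Fin n × Fin n) × (Fin T × Fin N)

/-- One epoch from `z₀`: run all `T` passes (and pay for all of them), then return the iterate
at the selected position. -/
noncomputable def epoch (f : Fin n → Vec d₁ → Vec d₂ → ℝ) (τ₁ τ₂ : ℝ) (seed : Seed n N T)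
    (z₀ : Vec d₁ × Vec d₂) : Counted (Vec d₁ × Vec d₂) :=
  ⟨iterate f τ₁ τ₂ seed.1 z₀ seed.2.1 seed.2.2, (outerLoop f τ₁ τ₂ seed.1 z₀ T le_rfl).calls⟩

/-- VR-AGDA: the point `(x^k, y^k)` after `k` epochs started at `z₀ = (x^0, y^0)`, with the
number of component gradients that were evaluated until then. -/
noncomputable def run (f : Fin n → Vec d₁ → Vec d₂ → ℝ) (τ₁ τ₂ : ℝ) (seed : ℕ → Seed n N T)
    (z₀ : Vec d₁ × Vec d₂) : ℕ → Counted (Vec d₁ × Vec d₂)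
  | 0 => pure z₀
  | k + 1 => do
      let z ← run f τ₁ τ₂ seed z₀ k
      epoch f τ₁ τ₂ (seed k) z

end Algorithm

/-! ### Randomness and the potential -/

open MeasureTheory ProbabilityTheory in
/-- The `seed k` are independent and each is uniformly distributed on the finite type `S`. For
`S = Seed n N T`, a product, this says that all single choices are independent and uniform. -/
structure IsIIDUniform {Ω : Type*} [MeasurableSpace Ω] (P : Measure Ω) {S : Type}
    [Fintype S] [MeasurableSpace S] (seed : ℕ → Ω → S) : Prop where
  measurable : ∀ k, Measurable (seed k)
  indep : iIndepFun seed P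
  uniform : ∀ k s, P {ω | seed k ω = s} = ((Fintype.card S : ℕ) : ENNReal)⁻¹

open MeasureTheory in
/-- The potential `E[g(x) - g*] + (1/20) E[g(x) - f(x, y)]` of a random point `z = (x, y)`. -/
noncomputable def potential {d₁ d₂ : ℕ} (f : Vec d₁ → Vec d₂ → ℝ) {Ω : Type*}
    [MeasurableSpace Ω] (P : Measure Ω) (z : Ω → Vec d₁ × Vec d₂) : ℝ :=
  (∫ ω, (primal f (z ω).1 - primalValue f) ∂P)
    + (1 / 20) * ∫ ω, (primal f (z ω).1 - f (z ω).1 (z ω).2) ∂P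

end VRAGDA

/-! The argument is a Lyapunov analysis. Let V = (g - g*) + (g - f)/20 at a point, let w be the
snapshot of the current pass, D the squared distance to w, and η = τ₂ l.

The primal function g need not be shown differentiable. At a maximizer y₀ of f(x, ·), the vector v =
∇_x f(x, y₀) is the slope of a quadratic upper model of g, because the PL condition in y controls
how far f(·, y₀) falls below g nearby. It satisfies ‖v‖² ≥ 2μ(g - g*), by the PL condition in x and
the saddle point, and its distance to ∇_x f(x, y) is controlled by g - f (`exists_primal_gradient`).
So the descent step lowers g - g* up to an error proportional to g - f. The ascent step pays for
this error, since τ₂ = 28κ²τ₁.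

The variance-reduced estimators are unbiased, and their second moment exceeds the squared full
gradient by at most 2l²D. This excess is absorbed by adding c_j D to V, with weights c_j that
decrease along the pass. One inner step then gives E[V' + c_{j+1} D'] ≤ (1 - τ₁μ/4) V + c_j D
(`expect_innerStep_le` with the recursion for c_j). Such weights exist when η³N² is small; with N of
order n, this is where the factor n^{2/3} in the stepsizes comes from.

As D = 0 at each snapshot, the sum telescopes over a pass and then over all passes
(`expect_innerLoop_le`, `expect_epoch_le`): τ₁μ/4 times the sum of all E[V] is at most the initial
V. The returned iterate is uniform among the NT points and τ₁μNT/4 ≥ 2, so an epoch halves V in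
expectation. Independence of the seeds carries this to `run`, and counting oracle calls gives the
complexity. -/

namespace VRAGDA

open scoped RealInnerProductSpace

/-! ### Quadratic models from Lipschitz gradients -/

section Smoothness

variable {d : ℕ} {F : Vec d → ℝ} {F' : Vec d → Vec d} {l : ℝ}

/-- The descent lemma: a function with `l`-Lipschitz gradient lies below its quadratic model. -/
theorem le_quadratic_model (hF : ∀ x, HasGradientAt F (F' x) x)
    (hl : ∀ x x', ‖F' x - F' x'‖ ≤ l * ‖x - x'‖) (x Δ : Vec d) :
    F (x + Δ) ≤ F x + ⟪F' x, Δ⟫ + l / 2 * ‖Δ‖ ^ 2 := by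
  -- Restriction to a segment minus the quadratic model. Its derivative is nonpositive on (0, 1) by
  -- Cauchy–Schwarz and the Lipschitz bound, so φ 1 ≤ φ 0.
  let φ : ℝ → ℝ := fun t => F (x + t • Δ) - t * ⟪F' x, Δ⟫ - l / 2 * ‖Δ‖ ^ 2 * t ^ 2
  have hline : ∀ t : ℝ, HasDerivAt (fun t : ℝ => x + t • Δ) Δ t := fun t => by
    simpa using ((hasDerivAt_id t).smul_const Δ).const_add x
  have hφ : ∀ t, HasDerivAt φ (⟪F' (x + t • Δ), Δ⟫ - ⟪F' x, Δ⟫ - l * ‖Δ‖ ^ 2 * t) t := fun t => by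
    have h1 : HasDerivAt (fun t : ℝ => F (x + t • Δ)) ⟪F' (x + t • Δ), Δ⟫ t := by
      refine ((hF (x + t • Δ)).hasFDerivAt.comp_hasDerivAt t (hline t)).congr_deriv ?_
      exact InnerProductSpace.toDual_apply_apply
    have h2 : HasDerivAt (fun t : ℝ => t * ⟪F' x, Δ⟫) ⟪F' x, Δ⟫ t := by
      simpa using (hasDerivAt_id t).mul_const ⟪F' x, Δ⟫
    have h3 := (hasDerivAt_pow 2 t).const_mul (l / 2 * ‖Δ‖ ^ 2)
    refine ((h1.sub h2).sub h3).congr_deriv ?_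
    simp only [Nat.cast_ofNat, Nat.add_one_sub_one, pow_one]
    ring
  have hanti : AntitoneOn φ (Set.Icc 0 1) := by
    refine antitoneOn_of_deriv_nonpos (convex_Icc 0 1)
      (fun t _ => (hφ t).continuousAt.continuousWithinAt)
      (fun t _ => (hφ t).differentiableAt.differentiableWithinAt) fun t ht => ?_
    rw [interior_Icc] at ht
    rw [(hφ t).deriv, ← inner_sub_left]
    have h1 := real_inner_le_norm (F' (x + t • Δ) - F' x) Δ
    have h2 := hl (x + t • Δ) x
    rw [add_sub_cancel_left, norm_smul, Real.norm_of_nonneg ht.1.le] at h2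
    nlinarith [mul_le_mul_of_nonneg_right h2 (norm_nonneg Δ)]
  have := hanti (Set.left_mem_Icc.2 zero_le_one) (Set.right_mem_Icc.2 zero_le_one) zero_le_one
  simp only [φ, one_smul, zero_smul, add_zero] at this
  linarith

theorem quadratic_model_le (hF : ∀ x, HasGradientAt F (F' x) x)
    (hl : ∀ x x', ‖F' x - F' x'‖ ≤ l * ‖x - x'‖) (x Δ : Vec d) :
    F x + ⟪F' x, Δ⟫ - l / 2 * ‖Δ‖ ^ 2 ≤ F (x + Δ) := by
  have hG : ∀ x, HasGradientAt (fun x => -F x) (-F' x) x := fun x => by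
    have := (hF x).hasFDerivAt.neg
    rw [hasGradientAt_iff_hasFDerivAt, map_neg]
    exact this
  have hl' : ∀ x x', ‖-F' x - -F' x'‖ ≤ l * ‖x - x'‖ := fun x x' => by
    rw [neg_sub_neg, norm_sub_rev]
    exact hl x x'
  have := le_quadratic_model hG hl' x Δ
  rw [inner_neg_left] at this
  linarith

end Smoothness

variable {d₁ d₂ : ℕ}

namespace HasLipschitzGradients

variable {f : Vec d₁ → Vec d₂ → ℝ} {l : ℝ}

theorem hasGradientAt_x (hf : HasLipschitzGradients f l) (x : Vec d₁) (y : Vec d₂) :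
    HasGradientAt (fun x => f x y) (gradX f x y) x := by
  have h := (hf.contDiff.differentiable one_ne_zero) (x, y)
  have h2 : DifferentiableAt ℝ (fun x' : Vec d₁ => (x', y)) x := by fun_prop
  exact (DifferentiableAt.comp x h h2).hasGradientAt

theorem hasGradientAt_y (hf : HasLipschitzGradients f l) (x : Vec d₁) (y : Vec d₂) :
    HasGradientAt (fun y => f x y) (gradY f x y) y := by
  have h := (hf.contDiff.differentiable one_ne_zero) (x, y)
  have h2 : DifferentiableAt ℝ (fun y' : Vec d₂ => (x, y')) y := by fun_prop
  exact (DifferentiableAt.comp y h h2).hasGradientAt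

theorem le_model_x (hf : HasLipschitzGradients f l) (x Δ : Vec d₁) (y : Vec d₂) :
    f (x + Δ) y ≤ f x y + ⟪gradX f x y, Δ⟫ + l / 2 * ‖Δ‖ ^ 2 :=
  le_quadratic_model (fun x => hf.hasGradientAt_x x y)
    (fun x x' => by simpa using hf.lipschitz_x x x' y y) x Δ

theorem model_le_x (hf : HasLipschitzGradients f l) (x Δ : Vec d₁) (y : Vec d₂) :
    f x y + ⟪gradX f x y, Δ⟫ - l / 2 * ‖Δ‖ ^ 2 ≤ f (x + Δ) y :=
  quadratic_model_le (fun x => hf.hasGradientAt_x x y)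
    (fun x x' => by simpa using hf.lipschitz_x x x' y y) x Δ

theorem model_le_y (hf : HasLipschitzGradients f l) (x : Vec d₁) (y Δ : Vec d₂) :
    f x y + ⟪gradY f x y, Δ⟫ - l / 2 * ‖Δ‖ ^ 2 ≤ f x (y + Δ) :=
  quadratic_model_le (fun y => hf.hasGradientAt_y x y)
    (fun y y' => by simpa using hf.lipschitz_y x x y y') y Δ

end HasLipschitzGradients

/-! ### Gradients of the finite average -/

section Average

variable {n : ℕ} {f : Fin n → Vec d₁ → Vec d₂ → ℝ} {l : ℝ}

theorem gradX_average (hf : ∀ i, HasLipschitzGradients (f i) l) (x : Vec d₁) (y : Vec d₂) :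
    gradX (average f) x y = (1 / (n : ℝ)) • ∑ i, gradX (f i) x y := by
  refine HasGradientAt.gradient ?_
  rw [hasGradientAt_iff_hasFDerivAt]
  have := (HasFDerivAt.fun_sum (u := Finset.univ)
    fun i _ => ((hf i).hasGradientAt_x x y).hasFDerivAt).const_mul (1 / (n : ℝ))
  rw [map_smul, map_sum]
  exact this

theorem gradY_average (hf : ∀ i, HasLipschitzGradients (f i) l) (x : Vec d₁) (y : Vec d₂) :
    gradY (average f) x y = (1 / (n : ℝ)) • ∑ i, gradY (f i) x y := by
  refine HasGradientAt.gradient ?_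
  rw [hasGradientAt_iff_hasFDerivAt]
  have := (HasFDerivAt.fun_sum (u := Finset.univ)
    fun i _ => ((hf i).hasGradientAt_y x y).hasFDerivAt).const_mul (1 / (n : ℝ))
  rw [map_smul, map_sum]
  exact this

theorem norm_mean_sub_mean_le {E : Type*} [NormedAddCommGroup E] [NormedSpace ℝ E] (hn : 1 ≤ n)
    (u v : Fin n → E) {c : ℝ} (h : ∀ i, ‖u i - v i‖ ≤ c) :
    ‖(1 / (n : ℝ)) • ∑ i, u i - (1 / (n : ℝ)) • ∑ i, v i‖ ≤ c := by
  have hn' : (0 : ℝ) < n := by exact_mod_cast hn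
  rw [← smul_sub, ← Finset.sum_sub_distrib, norm_smul, Real.norm_of_nonneg (by positivity)]
  have := norm_sum_le_of_le Finset.univ fun i _ => h i
  rw [Finset.sum_const, Finset.card_univ, Fintype.card_fin, nsmul_eq_mul] at this
  rw [one_div, inv_mul_le_iff₀ hn']
  exact this

theorem HasLipschitzGradients.average (hn : 1 ≤ n) (hf : ∀ i, HasLipschitzGradients (f i) l) :
    HasLipschitzGradients (average f) l where
  contDiff := contDiff_const.mul (ContDiff.sum fun i _ => (hf i).contDiff)
  lipschitz_x x₁ x₂ y₁ y₂ := by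
    rw [gradX_average hf, gradX_average hf]
    exact norm_mean_sub_mean_le hn _ _ fun i => (hf i).lipschitz_x x₁ x₂ y₁ y₂
  lipschitz_y x₁ x₂ y₁ y₂ := by
    rw [gradY_average hf, gradY_average hf]
    exact norm_mean_sub_mean_le hn _ _ fun i => (hf i).lipschitz_y x₁ x₂ y₁ y₂

end Average

/-! ### The primal function and its generalized gradient -/

section Primal

variable {f : Vec d₁ → Vec d₂ → ℝ} {l μ₁ μ₂ : ℝ}

namespace HasOptima

theorem le_primal (hO : HasOptima f) (x : Vec d₁) (y : Vec d₂) : f x y ≤ primal f x := by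
  obtain ⟨y₀, h⟩ := hO.exists_max x
  exact le_ciSup (f := fun y => f x y) ⟨f x y₀, by rintro _ ⟨y, rfl⟩; exact h y⟩ y

theorem exists_primal_eq (hO : HasOptima f) (x : Vec d₁) : ∃ y, primal f x = f x y := by
  obtain ⟨y₀, h⟩ := hO.exists_max x
  exact ⟨y₀, le_antisymm (ciSup_le h) (hO.le_primal x y₀)⟩

theorem exists_saddle_value (hO : HasOptima f) :
    ∃ x₀ y₀, primalValue f = f x₀ y₀ ∧ IsSaddlePoint f x₀ y₀ := by
  obtain ⟨x₀, y₀, h⟩ := hO.exists_saddle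
  have hlow : ∀ x, f x₀ y₀ ≤ primal f x := fun x => (h x y₀).2.trans (hO.le_primal x y₀)
  refine ⟨x₀, y₀, le_antisymm ?_ (le_ciInf hlow), h⟩
  exact (ciInf_le ⟨f x₀ y₀, by rintro _ ⟨x, rfl⟩; exact hlow x⟩ x₀).trans
    (ciSup_le fun y => (h x₀ y).1)

theorem primalValue_le (hO : HasOptima f) (x : Vec d₁) : primalValue f ≤ primal f x := by
  obtain ⟨x₀, y₀, h, hs⟩ := hO.exists_saddle_value
  exact h ▸ (hs x y₀).2.trans (hO.le_primal x y₀)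

/-- Evaluating at the saddle abscissa x₀ gives f(x₀, y) ≤ f(x₀, y₀) = g*. This turns the PL
condition in x, taken at a maximizer, into a PL inequality for g. -/
theorem iInf_le_primalValue (hO : HasOptima f) (y : Vec d₂) : ⨅ x, f x y ≤ primalValue f := by
  obtain ⟨x₀, y₀, h, hs⟩ := hO.exists_saddle_value
  obtain ⟨x₁, hx₁⟩ := hO.exists_min y
  exact h ▸ (ciInf_le ⟨f x₁ y, by rintro _ ⟨x, rfl⟩; exact hx₁ x⟩ x₀).trans (hs x₀ y).1

end HasOptima

/-- The condition in `y`, with the supremum written as the primal function. -/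
theorem TwoSidedPL.primal_gap_le (h : TwoSidedPL f μ₁ μ₂) (x : Vec d₁) (y : Vec d₂) :
    2 * μ₂ * (primal f x - f x y) ≤ ‖gradY f x y‖ ^ 2 := h.pl_y x y

/-- Both gaps are nonnegative, so smaller constants weaken the condition. It permits working with
the single constant μ = min(μ₁, μ₂), for which l = κμ. -/
theorem TwoSidedPL.mono {μ₁' μ₂' : ℝ} (hO : HasOptima f) (h : TwoSidedPL f μ₁ μ₂)
    (h₁ : μ₁' ≤ μ₁) (h₂ : μ₂' ≤ μ₂) : TwoSidedPL f μ₁' μ₂' where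
  pl_x x y := by
    obtain ⟨x₁, hx₁⟩ := hO.exists_min y
    have : ⨅ x', f x' y ≤ f x y := ciInf_le ⟨f x₁ y, by rintro _ ⟨x, rfl⟩; exact hx₁ x⟩ x
    nlinarith [h.pl_x x y]
  pl_y x y := by
    have h3 : f x y ≤ ⨆ y', f x y' := hO.le_primal x y
    nlinarith [h.pl_y x y]

theorem HasLipschitzGradients.gradY_eq_zero_of_max (hf : HasLipschitzGradients f l) {x : Vec d₁}
    {y : Vec d₂} (hy : ∀ y', f x y' ≤ f x y) : gradY f x y = 0 := by
  have h := (hf.hasGradientAt_y x y).hasFDerivAt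
  have hmax : IsLocalMax (fun y => f x y) y := Filter.Eventually.of_forall hy
  simpa using hmax.hasFDerivAt_eq_zero h

/-- The primal function lies below a quadratic model whose slope is the partial gradient at a
maximizer. -/
theorem primal_le_model (hf : HasLipschitzGradients f l) (hO : HasOptima f)
    (hPL : TwoSidedPL f μ₁ μ₂) (hμ : 0 < μ₂) {x : Vec d₁} {y : Vec d₂}
    (hy : primal f x = f x y) (Δ : Vec d₁) :
    primal f (x + Δ) ≤ primal f x + ⟪gradX f x y, Δ⟫ + (l / 2 + l ^ 2 / (2 * μ₂)) * ‖Δ‖ ^ 2 := by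
  have h0 : gradY f x y = 0 := hf.gradY_eq_zero_of_max fun y' => hy ▸ hO.le_primal x y'
  -- The y-gradient vanishes at (x, y), so at (x + Δ, y) it has norm at most l‖Δ‖. The PL condition
  -- then bounds the loss from keeping y fixed while x moves.
  have h1 := hf.lipschitz_y (x + Δ) x y y
  rw [h0, sub_zero, add_sub_cancel_left, sub_self, norm_zero, add_zero] at h1
  have h2 : 2 * μ₂ * (primal f (x + Δ) - f (x + Δ) y) ≤ l ^ 2 * ‖Δ‖ ^ 2 := by
    rw [← mul_pow]
    exact (hPL.primal_gap_le _ _).trans (pow_le_pow_left₀ (norm_nonneg _) h1 2)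
  have h3 : primal f (x + Δ) - f (x + Δ) y ≤ l ^ 2 / (2 * μ₂) * ‖Δ‖ ^ 2 := by
    rw [div_mul_eq_mul_div, le_div_iff₀ (by positivity)]
    linarith
  have h4 := hf.le_model_x x Δ y
  rw [hy]
  linarith

/-- A discriminant bound: test the nonnegative quadratic at its minimizer Δ = -(v - G)/(2q). -/
theorem norm_sub_sq_le_of_models {d : ℕ} {v G : Vec d} {b q : ℝ} (hq : 0 < q)
    (h : ∀ Δ : Vec d, 0 ≤ b + ⟪v - G, Δ⟫ + q * ‖Δ‖ ^ 2) : ‖v - G‖ ^ 2 ≤ 4 * q * b := by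
  have := h (-(1 / (2 * q)) • (v - G))
  rw [inner_smul_right, real_inner_self_eq_norm_sq, norm_smul, mul_pow, norm_neg, Real.norm_eq_abs,
    sq_abs] at this
  have h2 : b + -(1 / (2 * q)) * ‖v - G‖ ^ 2 + q * ((1 / (2 * q)) ^ 2 * ‖v - G‖ ^ 2)
      = b - ‖v - G‖ ^ 2 / (4 * q) := by
    field_simp
    ring
  rw [h2, sub_nonneg, div_le_iff₀ (by positivity)] at this
  linarith

/-- Every point has a generalized gradient `v` of the primal function: it gives a quadratic upper
model, satisfies the PL inequality and is close to the partial gradients. -/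
theorem exists_primal_gradient {κ μ : ℝ} (hf : HasLipschitzGradients f l) (hO : HasOptima f)
    (hPL : TwoSidedPL f μ μ) (hμ : 0 < μ) (hκ : 1 ≤ κ) (hl : l = κ * μ) (x : Vec d₁) :
    ∃ v : Vec d₁, (∀ Δ, primal f (x + Δ) ≤ primal f x + ⟪v, Δ⟫ + l * κ * ‖Δ‖ ^ 2) ∧
      2 * μ * (primal f x - primalValue f) ≤ ‖v‖ ^ 2 ∧
      ∀ y, ‖v - gradX f x y‖ ^ 2 ≤ 6 * (l * κ) * (primal f x - f x y) := by
  obtain ⟨y₀, hy₀⟩ := hO.exists_primal_eq x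
  have hl0 : 0 < l := by rw [hl]; positivity
  have hq : l ^ 2 / (2 * μ) = l * κ / 2 := by
    rw [hl]; field_simp
  have hlκ : l ≤ l * κ := le_mul_of_one_le_right hl0.le hκ
  have hmodel := primal_le_model hf hO hPL hμ hy₀
  rw [hq] at hmodel
  refine ⟨gradX f x y₀, fun Δ => (hmodel Δ).trans ?_, ?_, fun y => ?_⟩
  · gcongr
    linarith
  · have := hPL.pl_x x y₀
    have h2 := hO.iInf_le_primalValue y₀
    rw [hy₀]
    nlinarith
  · have hb : 0 ≤ primal f x - f x y := sub_nonneg.2 (hO.le_primal x y)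
    -- The upper model of g minus the lower model of f(·, y) is nonnegative because g ≥ f. Its
    -- curvature q is l + lκ/2 ≤ 3lκ/2, whence the constant 6 = 4 · 3/2.
    have := norm_sub_sq_le_of_models (v := gradX f x y₀) (G := gradX f x y)
      (b := primal f x - f x y) (q := l / 2 + l * κ / 2 + l / 2) (by positivity) fun Δ => by
        have h1 := hmodel Δ
        have h2 := hf.model_le_x x Δ y
        have h3 := hO.le_primal (x + Δ) y
        rw [inner_sub_left]
        linarith
    refine this.trans (mul_le_mul_of_nonneg_right ?_ hb)
    linarith

end Primal

end VRAGDA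

namespace VRAGDA

open scoped RealInnerProductSpace BigOperators

/-! ### Replacing an unused coordinate by an independent copy -/

section Resampling

variable {ι I Z : Type*} [DecidableEq ι]

/-- Exchange the coordinate `j` of a function with a separate value. -/
def swapCoordinate (j : ι) : (ι → I) × I ≃ (ι → I) × I where
  toFun p := (Function.update p.1 j p.2, p.1 j)
  invFun p := (Function.update p.1 j p.2, p.1 j)
  left_inv p := by simp
  right_inv p := by simp

variable [Fintype ι] [Fintype I] [Nonempty I]

/-- If `F` ignores the coordinate `j`, then `s j` may be replaced by an independent copy. -/
theorem expect_resample (j : ι) (F : (ι → I) → Z) (hF : ∀ s i, F (Function.update s j i) = F s)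
    (Ψ : I → Z → ℝ) : 𝔼 s : ι → I, Ψ (s j) (F s) = 𝔼 s : ι → I, 𝔼 i : I, Ψ i (F s) := by
  have h1 : 𝔼 s : ι → I, Ψ (s j) (F s) = 𝔼 p : (ι → I) × I, Ψ (p.1 j) (F p.1) := by
    rw [← Finset.univ_product_univ, Finset.expect_product]
    simp
  have h2 : 𝔼 s : ι → I, 𝔼 i : I, Ψ i (F s) = 𝔼 p : (ι → I) × I, Ψ p.2 (F p.1) := by
    rw [← Finset.univ_product_univ, Finset.expect_product]
  rw [h1, h2]
  refine Fintype.expect_equiv (swapCoordinate j) _ _ fun p => ?_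
  simp [swapCoordinate, hF]

end Resampling

/-! ### Moments of the variance-reduced estimator -/

section Moments

variable {n d : ℕ}

/-- The expectation of a quadratic function of a random vector with mean `m`. -/
theorem expect_le_of_quadratic (hn : 1 ≤ n) {h : Fin n → Vec d} {m p : Vec d} {V c q : ℝ}
    {φ : Fin n → ℝ} (hm : (1 / (n : ℝ)) • ∑ i, h i = m) (hV : 𝔼 i, ‖h i‖ ^ 2 ≤ V) (hq : 0 ≤ q)
    (hφ : ∀ i, φ i ≤ c + ⟪p, h i⟫ + q * ‖h i‖ ^ 2) : 𝔼 i, φ i ≤ c + ⟪p, m⟫ + q * V := by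
  have : Nonempty (Fin n) := ⟨⟨0, hn⟩⟩
  have h1 : 𝔼 i, φ i ≤ 𝔼 i, (c + ⟪p, h i⟫ + q * ‖h i‖ ^ 2) :=
    Finset.expect_le_expect fun i _ => hφ i
  have h2 : 𝔼 i, ⟪p, h i⟫ = ⟪p, m⟫ := by
    rw [← hm, inner_smul_right, inner_sum, Fintype.expect_eq_sum_div_card, Fintype.card_fin]
    ring
  rw [Finset.expect_add_distrib, Finset.expect_add_distrib, Fintype.expect_const, h2,
    ← Finset.mul_expect] at h1
  exact h1.trans (by gcongr)

theorem mean_sub_add (hn : 1 ≤ n) (a b : Fin n → Vec d) :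
    (1 / (n : ℝ)) • ∑ i, (a i - b i + (1 / (n : ℝ)) • ∑ i, b i) = (1 / (n : ℝ)) • ∑ i, a i := by
  have hn' : (n : ℝ) ≠ 0 := by positivity
  rw [Finset.sum_add_distrib, Finset.sum_sub_distrib, Finset.sum_const, Finset.card_univ,
    Fintype.card_fin, ← Nat.cast_smul_eq_nsmul ℝ, smul_smul, mul_one_div_cancel hn', one_smul,
    sub_add_cancel]

/-- The second moment of the variance-reduced estimator. -/
theorem expect_norm_sq_estimator_le (hn : 1 ≤ n) (a b : Fin n → Vec d) {c : ℝ}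
    (h : ∀ i, ‖a i - b i‖ ^ 2 ≤ c) :
    𝔼 i, ‖a i - b i + (1 / (n : ℝ)) • ∑ i, b i‖ ^ 2 ≤ ‖(1 / (n : ℝ)) • ∑ i, a i‖ ^ 2 + c := by
  have : Nonempty (Fin n) := ⟨⟨0, hn⟩⟩
  have hn' : (n : ℝ) ≠ 0 := by positivity
  set A := (1 / (n : ℝ)) • ∑ i, a i with hA
  set B := (1 / (n : ℝ)) • ∑ i, b i with hB
  have hsum : (1 / (n : ℝ)) • ∑ i, (a i - b i) = A - B := by
    rw [Finset.sum_sub_distrib, smul_sub]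
  have h1 := expect_le_of_quadratic hn (p := (2 : ℝ) • B) (c := ‖B‖ ^ 2) (q := 1) (V := c)
    (φ := fun i => ‖a i - b i + B‖ ^ 2) hsum
    ((Finset.expect_le_expect fun i _ => h i).trans_eq (Fintype.expect_const c)) zero_le_one
    fun i => by
      rw [norm_add_sq_real, inner_smul_left, real_inner_comm]
      simp only [conj_trivial]
      linarith
  -- Here ‖B‖² + 2⟪B, A - B⟫ = ‖A‖² - ‖A - B‖², and the last square is discarded.
  have h2 := norm_add_sq_real B (A - B)
  rw [add_sub_cancel] at h2
  rw [inner_smul_left, conj_trivial] at h1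
  linarith [sq_nonneg ‖A - B‖]

end Moments

end VRAGDA

/-! ### Expected decrease in one inner step -/

namespace VRAGDA

open scoped RealInnerProductSpace BigOperators

variable {d₁ d₂ n : ℕ}

/-- The potential of a deterministic point. -/
noncomputable def pointPotential (f : Vec d₁ → Vec d₂ → ℝ) (z : Vec d₁ × Vec d₂) : ℝ :=
  (primal f z.1 - primalValue f) + 1 / 20 * (primal f z.1 - f z.1 z.2)

/-- The squared Euclidean distance on the product. -/
noncomputable def sqDist (z w : Vec d₁ × Vec d₂) : ℝ := ‖z.1 - w.1‖ ^ 2 + ‖z.2 - w.2‖ ^ 2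

theorem sqDist_nonneg (z w : Vec d₁ × Vec d₂) : 0 ≤ sqDist z w := by
  unfold sqDist; positivity

theorem sqDist_self (z : Vec d₁ × Vec d₂) : sqDist z z = 0 := by simp [sqDist]

theorem HasOptima.pointPotential_nonneg {f : Vec d₁ → Vec d₂ → ℝ} (hO : HasOptima f)
    (z : Vec d₁ × Vec d₂) : 0 ≤ pointPotential f z := by
  have h1 := hO.primalValue_le z.1
  have h2 := hO.le_primal z.1 z.2
  unfold pointPotential
  linarith

theorem sq_le_of_lipschitz {a b c l : ℝ} (hc : 0 ≤ c) (h : c ≤ l * (a + b)) :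
    c ^ 2 ≤ 2 * l ^ 2 * (a ^ 2 + b ^ 2) := by
  have h1 : c ^ 2 ≤ (l * (a + b)) ^ 2 := pow_le_pow_left₀ hc h 2
  nlinarith [mul_nonneg (sq_nonneg l) (sq_nonneg (a - b))]

theorem inner_le_young {d : ℕ} (a b : Vec d) {r : ℝ} (hr : 0 < r) :
    2 * ⟪a, b⟫ ≤ 1 / r * ‖a‖ ^ 2 + r * ‖b‖ ^ 2 := by
  have h := sq_nonneg ‖a - r • b‖
  rw [norm_sub_sq_real, inner_smul_right, norm_smul, mul_pow, Real.norm_of_nonneg hr.le] at h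
  have h1 : 0 ≤ 1 / r * (‖a‖ ^ 2 - 2 * (r * ⟪a, b⟫) + r ^ 2 * ‖b‖ ^ 2) := by positivity
  have h2 : 1 / r * (‖a‖ ^ 2 - 2 * (r * ⟪a, b⟫) + r ^ 2 * ‖b‖ ^ 2)
      = 1 / r * ‖a‖ ^ 2 - 2 * ⟪a, b⟫ + r * ‖b‖ ^ 2 := by
    field_simp
  linarith

variable {f : Fin n → Vec d₁ → Vec d₂ → ℝ} {l κ μ η τ₁ τ₂ c N : ℝ}

/-- The variance-reduced estimator of `∇_x f` at `z` with the snapshot `w`. -/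
noncomputable def estimatorX (f : Fin n → Vec d₁ → Vec d₂ → ℝ) (w z : Vec d₁ × Vec d₂)
    (i : Fin n) : Vec d₁ :=
  gradX (f i) z.1 z.2 - gradX (f i) w.1 w.2 + (1 / (n : ℝ)) • ∑ i, gradX (f i) w.1 w.2

/-- The variance-reduced estimator of `∇_y f` at `z` with the snapshot `w`. -/
noncomputable def estimatorY (f : Fin n → Vec d₁ → Vec d₂ → ℝ) (w z : Vec d₁ × Vec d₂)
    (i : Fin n) : Vec d₂ :=
  gradY (f i) z.1 z.2 - gradY (f i) w.1 w.2 + (1 / (n : ℝ)) • ∑ i, gradY (f i) w.1 w.2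

theorem expect_norm_sq_estimatorX_le (hn : 1 ≤ n) (hf : ∀ i, HasLipschitzGradients (f i) l)
    (w z : Vec d₁ × Vec d₂) :
    𝔼 i, ‖estimatorX f w z i‖ ^ 2 ≤ ‖gradX (average f) z.1 z.2‖ ^ 2 + 2 * l ^ 2 * sqDist z w := by
  rw [gradX_average hf]
  exact expect_norm_sq_estimator_le hn _ _ fun i =>
    sq_le_of_lipschitz (norm_nonneg _) ((hf i).lipschitz_x z.1 w.1 z.2 w.2)

theorem expect_norm_sq_estimatorY_le (hn : 1 ≤ n) (hf : ∀ i, HasLipschitzGradients (f i) l)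
    (w z : Vec d₁ × Vec d₂) :
    𝔼 i, ‖estimatorY f w z i‖ ^ 2 ≤ ‖gradY (average f) z.1 z.2‖ ^ 2 + 2 * l ^ 2 * sqDist z w := by
  rw [gradY_average hf]
  exact expect_norm_sq_estimator_le hn _ _ fun i =>
    sq_le_of_lipschitz (norm_nonneg _) ((hf i).lipschitz_y z.1 w.1 z.2 w.2)

/-- The expected effect of the ascent step in `y`. -/
theorem expect_ascent_le (hn : 1 ≤ n) (hf : ∀ i, HasLipschitzGradients (f i) l)
    (hl : 0 < l) (hη : 0 < η) (hη' : η ≤ 1 / 50) (hτ₂ : τ₂ * l = η) (hN : 1 ≤ N) (hc : 0 < c)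
    (hcl : c ≤ l / 100) (hcN : 5 * N * c * τ₂ ≤ 1 / 2000) (w z : Vec d₁ × Vec d₂) :
    𝔼 i, (pointPotential (average f) (z.1, z.2 + τ₂ • estimatorY f w z i)
        + c * sqDist (z.1, z.2 + τ₂ • estimatorY f w z i) w)
      ≤ pointPotential (average f) z + c * sqDist z w + c / (4 * N) * ‖z.2 - w.2‖ ^ 2
        - 0.049 * τ₂ * ‖gradY (average f) z.1 z.2‖ ^ 2 + 0.1 * η ^ 2 * l * sqDist z w := by
  have hF := HasLipschitzGradients.average hn hf
  have hτ₂pos : 0 < τ₂ := pos_of_mul_pos_left (hτ₂ ▸ hη) hl.le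
  set H := gradY (average f) z.1 z.2 with hH
  have hmain := expect_le_of_quadratic hn (h := estimatorY f w z) (m := H)
    (p := (-(1 / 20) * τ₂) • H + (2 * c * τ₂) • (z.2 - w.2))
    (V := ‖H‖ ^ 2 + 2 * l ^ 2 * sqDist z w) (c := pointPotential (average f) z + c * sqDist z w)
    (q := (l / 40 + c) * τ₂ ^ 2)
    (φ := fun i => pointPotential (average f) (z.1, z.2 + τ₂ • estimatorY f w z i)
        + c * sqDist (z.1, z.2 + τ₂ • estimatorY f w z i) w)
    (by rw [hH, gradY_average hf]; exact mean_sub_add hn _ _)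
    (expect_norm_sq_estimatorY_le hn hf w z) (by positivity) fun i => by
      have h1 := hF.model_le_y z.1 z.2 (τ₂ • estimatorY f w z i)
      have h2 := norm_add_sq_real (z.2 - w.2) (τ₂ • estimatorY f w z i)
      rw [sub_add_eq_add_sub] at h2
      simp only [pointPotential, sqDist, inner_add_left, inner_smul_left, inner_smul_right,
        conj_trivial, norm_smul, mul_pow, Real.norm_eq_abs, sq_abs, ← hH] at h1 h2 ⊢
      rw [h2]
      linarith
  refine hmain.trans ?_
  rw [inner_add_left, inner_smul_left, inner_smul_left, conj_trivial, conj_trivial,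
    real_inner_self_eq_norm_sq]
  -- This weight makes the distance coefficient grow only by the factor 1 + 1/(4N) per step, which
  -- is affordable over N steps.
  have hy := inner_le_young (z.2 - w.2) H (r := 4 * N * τ₂) (by positivity)
  have hy' : 2 * c * τ₂ * ⟪z.2 - w.2, H⟫
      ≤ c / (4 * N) * ‖z.2 - w.2‖ ^ 2 + 4 * N * c * τ₂ * τ₂ * ‖H‖ ^ 2 := by
    have := mul_le_mul_of_nonneg_left hy (by positivity : 0 ≤ c * τ₂)
    have e : c * τ₂ * (1 / (4 * N * τ₂) * ‖z.2 - w.2‖ ^ 2 + 4 * N * τ₂ * ‖H‖ ^ 2)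
      = c / (4 * N) * ‖z.2 - w.2‖ ^ 2 + 4 * N * c * τ₂ * τ₂ * ‖H‖ ^ 2 := by
      field_simp
    linarith
  have hD := sqDist_nonneg z w
  have hcτ : c * τ₂ ≤ N * (c * τ₂) := le_mul_of_one_le_left (by positivity) hN
  -- Of the gain 1/20, at most 1/2000 is lost to the c-terms (by `hcN`) and 1/2000 to the curvature
  -- term η/40, leaving 0.049.
  have hH2 : (4 * N * c * τ₂ + (l / 40 + c) * τ₂ - 1 / 20) * (τ₂ * ‖H‖ ^ 2)
      ≤ -0.049 * (τ₂ * ‖H‖ ^ 2) := by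
    refine mul_le_mul_of_nonneg_right ?_ (by positivity)
    linarith
  have hD2 : (l / 40 + c) * 2 * (η ^ 2 * sqDist z w) ≤ 0.1 * l * (η ^ 2 * sqDist z w) := by
    refine mul_le_mul_of_nonneg_right ?_ (by positivity)
    linarith
  have e : (l / 40 + c) * τ₂ ^ 2 * (2 * l ^ 2 * sqDist z w)
      = (l / 40 + c) * 2 * (η ^ 2 * sqDist z w) := by
    rw [← hτ₂]; ring
  linarith

/-- A pointwise quadratic bound for the descent step in `x`. -/
theorem descent_le_quadratic {F : Vec d₁ → Vec d₂ → ℝ} (hF : HasLipschitzGradients F l)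
    (hκ : 1 ≤ κ) (hη : 0 < η) (hη' : η ≤ 1 / 50) (hτ₂ : τ₂ * l = η)
    (hl : 0 < l) (hc : 0 < c) (hcl : c ≤ l / 100) {v : Vec d₁} (w z : Vec d₁ × Vec d₂)
    (hv : ∀ Δ, primal F (z.1 + Δ) ≤ primal F z.1 + ⟪v, Δ⟫ + l * κ * ‖Δ‖ ^ 2) (u : Vec d₁) :
    pointPotential F (z.1 - τ₁ • u, z.2)
        + c * sqDist (z.1 - τ₁ • u, z.2) w + c / (4 * N) * ‖z.2 - w.2‖ ^ 2
        - 0.049 * τ₂ * ‖gradY F (z.1 - τ₁ • u) z.2‖ ^ 2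
        + 0.1 * η ^ 2 * l * sqDist (z.1 - τ₁ • u, z.2) w
      ≤ pointPotential F z + c * sqDist z w + 0.2 * η ^ 2 * l * sqDist z w
        + c / (4 * N) * ‖z.2 - w.2‖ ^ 2 - 0.0466 * τ₂ * ‖gradY F z.1 z.2‖ ^ 2
        + ⟪(-(21 / 20) * τ₁) • v + (τ₁ / 20) • gradX F z.1 z.2 - (2 * c * τ₁) • (z.1 - w.1), u⟫
        + 1.2 * l * κ * τ₁ ^ 2 * ‖u‖ ^ 2 := by
  have hτ₂pos : 0 < τ₂ := pos_of_mul_pos_left (hτ₂ ▸ hη) hl.le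
  have hlκ' : l ≤ l * κ := le_mul_of_one_le_right hl.le hκ
  set H := gradY F z.1 z.2
  have h1 := hF.model_le_x z.1 (-(τ₁ • u)) z.2
  have h2 := hv (-(τ₁ • u))
  have h3 := norm_sub_sq_real (z.1 - w.1) (τ₁ • u)
  have h4 : ‖z.1 - w.1 - τ₁ • u‖ ^ 2 ≤ 2 * ‖z.1 - w.1‖ ^ 2 + 2 * ‖τ₁ • u‖ ^ 2 := by
    have := parallelogram_law_with_norm ℝ (z.1 - w.1) (τ₁ • u)
    nlinarith [norm_nonneg (z.1 - w.1 + τ₁ • u)]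
  have h5 := hF.lipschitz_y (z.1 - τ₁ • u) z.1 z.2 z.2
  set H' := gradY F (z.1 - τ₁ • u) z.2
  rw [sub_sub_cancel_left, norm_neg, sub_self, norm_zero, add_zero] at h5
  have h6 : ‖H' - H‖ ^ 2 ≤ l ^ 2 * ‖τ₁ • u‖ ^ 2 := by
    rw [← mul_pow]; exact pow_le_pow_left₀ (norm_nonneg _) h5 2
  -- The ascent gain involves the gradient at the new x. It is moved to the old x at the cost of a
  -- term quadratic in the step; 0.049 · 20/21 still exceeds 0.0466.
  have h7 : 20 / 21 * ‖H‖ ^ 2 - 20 * (l ^ 2 * ‖τ₁ • u‖ ^ 2) ≤ ‖H'‖ ^ 2 := by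
    have e1 := norm_sub_sq_real H' H
    have e2 := inner_le_young H H' (r := 21 / 20) (by norm_num)
    rw [real_inner_comm] at e2
    linarith
  rw [sub_right_comm] at h3 h4
  rw [← sub_eq_add_neg, inner_neg_right, norm_neg] at h1 h2
  have hD := sq_nonneg ‖z.1 - w.1‖
  have hD' := sq_nonneg ‖z.2 - w.2‖
  have h8 := mul_le_mul_of_nonneg_left h7 (by positivity : 0 ≤ 0.049 * τ₂)
  have h9 := mul_le_mul_of_nonneg_left h4 (by positivity : 0 ≤ 0.1 * η ^ 2 * l)
  have e3 : 0.049 * τ₂ * (20 * (l ^ 2 * ‖τ₁ • u‖ ^ 2)) = 0.98 * η * l * ‖τ₁ • u‖ ^ 2 := by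
    rw [← hτ₂]; ring
  have h10 : 0.0466 * (τ₂ * ‖H‖ ^ 2) ≤ 0.049 * τ₂ * (20 / 21 * ‖H‖ ^ 2) := by
    have : 0 ≤ τ₂ * ‖H‖ ^ 2 := by positivity
    linarith
  have h11 : η * l ≤ 1 / 50 * l := by gcongr
  have h12 : η ^ 2 * l ≤ 1 / 50 * l := by
    gcongr
    nlinarith
  have h13 : (1.05 * (l * κ) + l / 40 + c + 0.98 * η * l + 0.2 * η ^ 2 * l) * ‖τ₁ • u‖ ^ 2
      ≤ 1.2 * l * κ * ‖τ₁ • u‖ ^ 2 := by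
    refine mul_le_mul_of_nonneg_right ?_ (sq_nonneg _)
    linarith
  have h14 : 0 ≤ 0.1 * η ^ 2 * l * ‖z.2 - w.2‖ ^ 2 := by positivity
  have e4 : ‖τ₁ • u‖ ^ 2 = τ₁ ^ 2 * ‖u‖ ^ 2 := by
    rw [norm_smul, mul_pow, Real.norm_eq_abs, sq_abs]
  have e5 : 1.2 * l * κ * τ₁ ^ 2 * ‖u‖ ^ 2 = 1.2 * l * κ * ‖τ₁ • u‖ ^ 2 := by
    rw [e4]; ring
  rw [e5]
  simp only [pointPotential, sqDist, inner_add_left, inner_sub_left, inner_smul_left,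
    inner_smul_right, conj_trivial] at h1 h2 h3 ⊢
  rw [h3] at h9 ⊢
  linarith

/-- The expected effect of the descent step in `x` on the bound of `expect_ascent_le`. -/
theorem expect_descent_le (hn : 1 ≤ n) (hf : ∀ i, HasLipschitzGradients (f i) l)
    (hO : HasOptima (average f)) (hPL : TwoSidedPL (average f) μ μ) (hμ : 0 < μ) (hκ : 1 ≤ κ)
    (hlκ : l = κ * μ) (hη : 0 < η) (hη' : η ≤ 1 / 50) (hτ₂ : τ₂ * l = η)
    (hτ₁ : τ₂ = 28 * κ ^ 2 * τ₁) (hN : 1 ≤ N) (hc : 0 < c)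
    (hcl : c ≤ l / 100) (hcN : 5 * N * c * τ₂ ≤ 1 / 2000) (w z : Vec d₁ × Vec d₂) :
    𝔼 i, (pointPotential (average f) (z.1 - τ₁ • estimatorX f w z i, z.2)
        + c * sqDist (z.1 - τ₁ • estimatorX f w z i, z.2) w + c / (4 * N) * ‖z.2 - w.2‖ ^ 2
        - 0.049 * τ₂ * ‖gradY (average f) (z.1 - τ₁ • estimatorX f w z i) z.2‖ ^ 2
        + 0.1 * η ^ 2 * l * sqDist (z.1 - τ₁ • estimatorX f w z i, z.2) w)
      ≤ pointPotential (average f) z + (c * (1 + 1 / (4 * N)) + 0.21 * η ^ 2 * l) * sqDist z w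
        - τ₁ * μ / 4 * pointPotential (average f) z := by
  have hF := HasLipschitzGradients.average hn hf
  have hl : 0 < l := by rw [hlκ]; positivity
  have hτ₂pos : 0 < τ₂ := pos_of_mul_pos_left (hτ₂ ▸ hη) hl.le
  have hτ₁pos : 0 < τ₁ := pos_of_mul_pos_right (hτ₁ ▸ hτ₂pos) (by positivity)
  have hlκ' : l ≤ l * κ := le_mul_of_one_le_right hl.le hκ
  obtain ⟨v, hv, hvPL, hve⟩ := exists_primal_gradient hF hO hPL hμ hκ hlκ z.1
  set G := gradX (average f) z.1 z.2 with hG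
  set H := gradY (average f) z.1 z.2 with hH
  set b := primal (average f) z.1 - average f z.1 z.2 with hb
  set a := primal (average f) z.1 - primalValue (average f) with ha
  have hmain := expect_le_of_quadratic hn (h := estimatorX f w z) (m := G)
    (p := (-(21 / 20) * τ₁) • v + (τ₁ / 20) • G - (2 * c * τ₁) • (z.1 - w.1))
    (V := ‖G‖ ^ 2 + 2 * l ^ 2 * sqDist z w)
    (c := pointPotential (average f) z + c * sqDist z w + 0.2 * η ^ 2 * l * sqDist z w
      + c / (4 * N) * ‖z.2 - w.2‖ ^ 2 - 0.0466 * τ₂ * ‖H‖ ^ 2)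
    (q := 1.2 * l * κ * τ₁ ^ 2)
    (φ := fun i => pointPotential (average f) (z.1 - τ₁ • estimatorX f w z i, z.2)
        + c * sqDist (z.1 - τ₁ • estimatorX f w z i, z.2) w + c / (4 * N) * ‖z.2 - w.2‖ ^ 2
        - 0.049 * τ₂ * ‖gradY (average f) (z.1 - τ₁ • estimatorX f w z i) z.2‖ ^ 2
        + 0.1 * η ^ 2 * l * sqDist (z.1 - τ₁ • estimatorX f w z i, z.2) w)
    (by rw [hG, gradX_average hf]; exact mean_sub_add hn _ _)
    (expect_norm_sq_estimatorX_le hn hf w z) (by positivity) fun i => by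
      exact descent_le_quadratic hF hκ hη hη' hτ₂ hl hc hcl w z hv _
  refine hmain.trans ?_
  rw [inner_sub_left, inner_add_left, inner_smul_left, inner_smul_left, inner_smul_left,
    conj_trivial, conj_trivial, conj_trivial, real_inner_self_eq_norm_sq]
  have hD := sqDist_nonneg z w
  have ha0 : 0 ≤ a := sub_nonneg.2 (hO.primalValue_le z.1)
  have hb0 : 0 ≤ b := sub_nonneg.2 (hO.le_primal z.1 z.2)
  have hτle : τ₁ ≤ τ₂ := by
    rw [hτ₁]
    have : 1 ≤ κ ^ 2 := one_le_pow₀ hκ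
    exact le_mul_of_one_le_left hτ₁pos.le (by linarith)
  have hy : -(2 * c * τ₁ * ⟪z.1 - w.1, G⟫)
      ≤ c / (4 * N) * ‖z.1 - w.1‖ ^ 2 + 4 * N * c * τ₁ * τ₁ * ‖G‖ ^ 2 := by
    have hy := inner_le_young (-(z.1 - w.1)) G (r := 4 * N * τ₁) (by positivity)
    rw [inner_neg_left, norm_neg] at hy
    have := mul_le_mul_of_nonneg_left hy (by positivity : 0 ≤ c * τ₁)
    have e : c * τ₁ * (1 / (4 * N * τ₁) * ‖z.1 - w.1‖ ^ 2 + 4 * N * τ₁ * ‖G‖ ^ 2)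
      = c / (4 * N) * ‖z.1 - w.1‖ ^ 2 + 4 * N * c * τ₁ * τ₁ * ‖G‖ ^ 2 := by
      field_simp
    linarith
  have hlκτ : l * κ * τ₁ = τ₂ * μ / 28 := by rw [hτ₁, hlκ]; ring
  have hτμ : τ₂ * μ ≤ η := by
    rw [← hτ₂, hlκ]
    have : μ ≤ κ * μ := le_mul_of_one_le_left hμ.le hκ
    gcongr
  have hG2 : (4 * N * c * τ₁ + 1.2 * (l * κ * τ₁)) * (τ₁ * ‖G‖ ^ 2) ≤ 0.002 * (τ₁ * ‖G‖ ^ 2) := by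
    refine mul_le_mul_of_nonneg_right ?_ (by positivity)
    have h1 : N * c * τ₁ ≤ N * c * τ₂ := by gcongr
    have h2 : 0 ≤ N * c * τ₂ := by positivity
    rw [hlκτ]
    linarith
  have hD2 : 1.2 * l * κ * τ₁ ^ 2 * (2 * l ^ 2 * sqDist z w) ≤ 0.01 * η ^ 2 * l * sqDist z w := by
    have h1 : l * τ₁ ≤ η / 28 := by
      have : l * τ₁ ≤ l * κ * τ₁ := by gcongr
      linarith
    have h2 : l * κ * τ₁ ≤ η / 28 := by linarith
    have h3 : l * κ * τ₁ * (l * τ₁) ≤ η / 28 * (η / 28) := by gcongr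
    have h4 := mul_le_mul_of_nonneg_right h3 (by positivity : 0 ≤ 2.4 * l * sqDist z w)
    have h5 : 0 ≤ η ^ 2 * l * sqDist z w := by positivity
    linarith
  -- The coefficient 0.052 is 1/20 from the f-part of the potential plus 0.002 from `hG2`. The
  -- -0.14‖v‖² yields -0.28 τ₁μa by PL, enough for the rate 1/4. The error 0.3153‖v - G‖² costs
  -- about 0.068 τ₂μb, less than the ascent gain 0.0932 τ₂μb.
  have hinner : -(21 / 20) * ⟪v, G⟫ + 0.052 * ‖G‖ ^ 2
      ≤ -0.14 * ‖v‖ ^ 2 + 0.3153 * ‖v - G‖ ^ 2 := by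
    have h1 := sq_nonneg ‖v + (1.2 : ℝ) • G‖
    rw [norm_add_sq_real, inner_smul_right, norm_smul, mul_pow, Real.norm_of_nonneg (by norm_num)]
      at h1
    rw [norm_sub_sq_real]
    linarith [sq_nonneg ‖G‖, sq_nonneg ‖v‖]
  have hinner' := mul_le_mul_of_nonneg_left hinner hτ₁pos.le
  have hv1 := mul_le_mul_of_nonneg_left hvPL hτ₁pos.le
  have hv2 := mul_le_mul_of_nonneg_left (hve z.2) hτ₁pos.le
  have hv2' : τ₁ * ‖v - G‖ ^ 2 ≤ 6 / 28 * (τ₂ * μ * b) := by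
    have e : τ₁ * (6 * (l * κ) * b) = 6 / 28 * (τ₂ * μ * b) := by
      linear_combination 6 * b * hlκτ
    rw [← e]
    exact hv2
  have hHPL : 2 * (τ₂ * μ * b) ≤ τ₂ * ‖H‖ ^ 2 := by
    have := mul_le_mul_of_nonneg_left (hPL.primal_gap_le z.1 z.2) hτ₂pos.le
    linarith
  have hτμ₁ : τ₁ * μ * b ≤ τ₂ * μ * b := by gcongr
  have hτμa : 0 ≤ τ₁ * μ * a := by positivity
  have hτμb : 0 ≤ τ₁ * μ * b := by positivity
  have hpot : τ₁ * μ / 4 * pointPotential (average f) z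
      = τ₁ * μ * a / 4 + τ₁ * μ * b / 80 := by
    simp only [pointPotential, ← ha, ← hb]; ring
  rw [hpot]
  have hsq : c * (1 / (4 * N)) * sqDist z w
      = c / (4 * N) * ‖z.1 - w.1‖ ^ 2 + c / (4 * N) * ‖z.2 - w.2‖ ^ 2 := by
    unfold sqDist; ring
  linarith

/-- One inner step decreases the potential plus a multiple of the squared distance to the
snapshot. -/
theorem expect_innerStep_le (hn : 1 ≤ n) (hf : ∀ i, HasLipschitzGradients (f i) l)
    (hO : HasOptima (average f)) (hPL : TwoSidedPL (average f) μ μ) (hμ : 0 < μ) (hκ : 1 ≤ κ)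
    (hlκ : l = κ * μ) (hη : 0 < η) (hη' : η ≤ 1 / 50) (hτ₂ : τ₂ * l = η)
    (hτ₁ : τ₂ = 28 * κ ^ 2 * τ₁) (hN : 1 ≤ N) (hc : 0 < c)
    (hcl : c ≤ l / 100) (hcN : 5 * N * c * τ₂ ≤ 1 / 2000) (w z : Vec d₁ × Vec d₂) :
    𝔼 i : Fin n × Fin n,
        (pointPotential (average f) (innerStep f τ₁ τ₂ w (fullGradient f w).val i z).val
          + c * sqDist (innerStep f τ₁ τ₂ w (fullGradient f w).val i z).val w)
      ≤ pointPotential (average f) z + (c * (1 + 1 / (4 * N)) + 0.21 * η ^ 2 * l) * sqDist z w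
        - τ₁ * μ / 4 * pointPotential (average f) z := by
  have hl : 0 < l := by rw [hlκ]; positivity
  refine le_trans ?_ (expect_descent_le hn hf hO hPL hμ hκ hlκ hη hη' hτ₂ hτ₁ hN hc hcl hcN w z)
  -- The two indices are independent: the ascent index is averaged first, with the new x held fixed.
  rw [← Finset.univ_product_univ, Finset.expect_product]
  exact Finset.expect_le_expect fun i _ =>
    expect_ascent_le hn hf hl hη hη' hτ₂ hN hc hcl hcN w (z.1 - τ₁ • estimatorX f w z i, z.2)

end VRAGDA

/-! ### Oracle counts and telescoping over passes and epochs -/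

namespace VRAGDA

open scoped RealInnerProductSpace BigOperators

/-- Telescoping for quantities that exist only up to the loop bound; it serves both loops. -/
theorem add_sum_le_of_step {N : ℕ} (A : (j : ℕ) → j ≤ N → ℝ) (B : Fin N → ℝ)
    (h : ∀ j : Fin N, A (j + 1) j.is_lt + B j ≤ A j j.is_lt.le) :
    A N le_rfl + ∑ j, B j ≤ A 0 (Nat.zero_le N) := by
  induction N with
  | zero => simp
  | succ N ih =>
    have h1 := ih (fun j hj => A j (hj.trans N.le_succ)) (fun j => B j.castSucc)
      fun j => h j.castSucc
    have h2 := h (Fin.last N)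
    rw [Fin.sum_univ_castSucc]
    simp only [Fin.val_last] at h2
    linarith

variable {d₁ d₂ n N T : ℕ} {f : Fin n → Vec d₁ → Vec d₂ → ℝ} {l κ μ η τ₁ τ₂ ρ : ℝ}

section Calls

theorem innerLoop_calls (w u : Vec d₁ × Vec d₂) (s : Fin N → Fin n × Fin n) (j : ℕ) (h : j ≤ N) :
    (innerLoop f τ₁ τ₂ w u s j h).calls = 4 * j := by
  induction j with
  | zero => rfl
  | succ j ih =>
    change (innerLoop f τ₁ τ₂ w u s j _).calls + 4 = 4 * (j + 1)
    rw [ih]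
    ring

theorem fullGradient_calls (w : Vec d₁ × Vec d₂) : (fullGradient f w).calls = 2 * n := by
  change ∑ _i : Fin n, 1 + (∑ _i : Fin n, 1 + 0) = 2 * n
  simp
  ring

theorem outerLoop_calls (s : Fin T → Fin N → Fin n × Fin n) (z₀ : Vec d₁ × Vec d₂) (t : ℕ)
    (h : t ≤ T) : (outerLoop f τ₁ τ₂ s z₀ t h).calls = t * (2 * n + 4 * N) := by
  induction t with
  | zero => exact (zero_mul _).symm
  | succ t ih =>
    have h1 : (outerLoop f τ₁ τ₂ s z₀ (t + 1) h).calls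
        = (outerLoop f τ₁ τ₂ s z₀ t (Nat.le_of_succ_le h)).calls
          + ((fullGradient f (outerLoop f τ₁ τ₂ s z₀ t (Nat.le_of_succ_le h)).val).calls
          + (innerLoop f τ₁ τ₂ (outerLoop f τ₁ τ₂ s z₀ t (Nat.le_of_succ_le h)).val
            (fullGradient f (outerLoop f τ₁ τ₂ s z₀ t (Nat.le_of_succ_le h)).val).val
            (s ⟨t, h⟩) N le_rfl).calls) := rfl
    rw [h1, ih, fullGradient_calls, innerLoop_calls]
    ring

theorem run_calls (seed : ℕ → Seed n N T) (z₀ : Vec d₁ × Vec d₂) (k : ℕ) :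
    (run f τ₁ τ₂ seed z₀ k).calls = k * (T * (2 * n + 4 * N)) := by
  induction k with
  | zero => exact (zero_mul _).symm
  | succ k ih =>
    change (run f τ₁ τ₂ seed z₀ k).calls
      + (outerLoop f τ₁ τ₂ (seed k).1 (run f τ₁ τ₂ seed z₀ k).val T le_rfl).calls = _
    rw [ih, outerLoop_calls]
    ring

end Calls

section Adapted

/-- The first j steps read only the indices before j. This is the hypothesis of `expect_resample`
that makes the index of step j fresh. -/
theorem innerLoop_update (w u : Vec d₁ × Vec d₂) (s : Fin N → Fin n × Fin n) (j : Fin N)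
    (i : Fin n × Fin n) (k : ℕ) (hk : k ≤ N) (hkj : k ≤ j) :
    innerLoop f τ₁ τ₂ w u (Function.update s j i) k hk = innerLoop f τ₁ τ₂ w u s k hk := by
  induction k with
  | zero => rfl
  | succ k ih =>
    have hne : (⟨k, hk⟩ : Fin N) ≠ j := fun h => by
      rw [← h] at hkj
      exact absurd hkj (by simp)
    simp only [innerLoop, ih (Nat.le_of_succ_le hk) (Nat.le_of_succ_le hkj),
      Function.update_of_ne hne]

theorem outerLoop_update (s : Fin T → Fin N → Fin n × Fin n) (z₀ : Vec d₁ × Vec d₂) (t : Fin T)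
    (r : Fin N → Fin n × Fin n) (k : ℕ) (hk : k ≤ T) (hkt : k ≤ t) :
    outerLoop f τ₁ τ₂ (Function.update s t r) z₀ k hk = outerLoop f τ₁ τ₂ s z₀ k hk := by
  induction k with
  | zero => rfl
  | succ k ih =>
    have hne : (⟨k, hk⟩ : Fin T) ≠ t := fun h => by
      rw [← h] at hkt
      exact absurd hkt (by simp)
    simp only [outerLoop, ih (Nat.le_of_succ_le hk) (Nat.le_of_succ_le hkt),
      Function.update_of_ne hne]

end Adapted

/-- One pass of the inner loop: the sum of the potentials along the pass is paid by the decrease of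
the potential. -/
theorem expect_innerLoop_le (hn : 1 ≤ n) (hf : ∀ i, HasLipschitzGradients (f i) l)
    (hO : HasOptima (average f)) (hPL : TwoSidedPL (average f) μ μ) (hμ : 0 < μ) (hκ : 1 ≤ κ)
    (hlκ : l = κ * μ) (hη : 0 < η) (hη' : η ≤ 1 / 50) (hτ₂ : τ₂ * l = η)
    (hτ₁ : τ₂ = 28 * κ ^ 2 * τ₁) (hN : 1 ≤ N) (hηN : η ^ 3 * (N : ℝ) ^ 2 ≤ 1 / 10000)
    (w : Vec d₁ × Vec d₂) :
    𝔼 s : Fin N → Fin n × Fin n,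
        pointPotential (average f) (innerLoop f τ₁ τ₂ w (fullGradient f w).val s N le_rfl).val
      + ∑ j : Fin N, τ₁ * μ / 4 * 𝔼 s : Fin N → Fin n × Fin n, pointPotential (average f)
          (innerLoop f τ₁ τ₂ w (fullGradient f w).val s j j.is_lt.le).val
      ≤ pointPotential (average f) w := by
  have : Nonempty (Fin n) := ⟨⟨0, hn⟩⟩
  have hl : 0 < l := by rw [hlκ]; positivity
  have hN' : (1 : ℝ) ≤ N := by exact_mod_cast hN
  have hη2 : η ^ 2 * N ≤ 1 / 100 := by
    refine abs_le_of_sq_le_sq' ?_ (by norm_num) |>.2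
    have h1 : η * (η ^ 3 * (N : ℝ) ^ 2) ≤ 1 * (1 / 10000) := by
      gcongr
      linarith
    calc (η ^ 2 * N) ^ 2 = η * (η ^ 3 * (N : ℝ) ^ 2) := by ring
      _ ≤ _ := h1
      _ = (1 / 100) ^ 2 := by norm_num
  -- Each step releases η²l/2 of weight. It must cover 0.21 η²l of variance and c/(4N) ≤ η²l/4 from
  -- Young's inequality. Starting from 2N rather than N is not needed for positivity of the last
  -- weight but is harmless: all weights stay at most η²lN.
  let c : ℕ → ℝ := fun j => 1 / 2 * η ^ 2 * l * (2 * N - j)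
  let Z : (s : Fin N → Fin n × Fin n) → (j : ℕ) → j ≤ N → Vec d₁ × Vec d₂ :=
    fun s j h => (innerLoop f τ₁ τ₂ w (fullGradient f w).val s j h).val
  have key := add_sum_le_of_step
    (fun j h => 𝔼 s, (pointPotential (average f) (Z s j h) + c j * sqDist (Z s j h) w))
    (fun j => τ₁ * μ / 4 * 𝔼 s, pointPotential (average f) (Z s j j.is_lt.le)) fun j => by
      have hj : (j : ℝ) + 1 ≤ N := by exact_mod_cast j.is_lt
      have hj0 : (0 : ℝ) ≤ j := Nat.cast_nonneg _
      have hηl : 0 < η ^ 2 * l := by positivity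
      have hcpos : 0 < c (j + 1) := by
        simp only [c, Nat.cast_add, Nat.cast_one]
        have : (0 : ℝ) < 2 * N - (j + 1) := by linarith
        positivity
      have hcle : c (j + 1) ≤ η ^ 2 * l * N := by
        simp only [c, Nat.cast_add, Nat.cast_one]
        have : η ^ 2 * l * (2 * N - (j + 1)) ≤ η ^ 2 * l * (2 * N) := by
          gcongr
          linarith
        linarith
      have hcl : c (j + 1) ≤ l / 100 := by
        have := mul_le_mul_of_nonneg_left hη2 hl.le
        linarith
      have hτ₂pos : 0 < τ₂ := pos_of_mul_pos_left (hτ₂ ▸ hη) hl.le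
      have hcN : 5 * N * c (j + 1) * τ₂ ≤ 1 / 2000 := by
        calc 5 * N * c (j + 1) * τ₂ ≤ 5 * N * (η ^ 2 * l * N) * τ₂ := by gcongr
          _ = 5 * (η ^ 3 * (N : ℝ) ^ 2) := by rw [← hτ₂]; ring
          _ ≤ _ := by linarith
      have hrec : c (j + 1) * (1 + 1 / (4 * N)) + 0.21 * η ^ 2 * l ≤ c j := by
        have h1 : c (j + 1) * (1 / (4 * N)) ≤ η ^ 2 * l / 4 := by
          calc c (j + 1) * (1 / (4 * N)) ≤ η ^ 2 * l * N * (1 / (4 * N)) := by gcongr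
            _ = η ^ 2 * l / 4 := by field_simp
        have h2 : c j = c (j + 1) + η ^ 2 * l / 2 := by
          simp only [c, Nat.cast_add, Nat.cast_one]
          ring
        linarith
      have hstep := fun z => expect_innerStep_le hn hf hO hPL hμ hκ hlκ hη hη' hτ₂ hτ₁ hN' hcpos
        hcl hcN w z
      have hres := expect_resample (I := Fin n × Fin n) j (fun s => Z s j j.is_lt.le)
        (fun s i => congrArg Counted.val (innerLoop_update w _ s j i j j.is_lt.le le_rfl))
        (fun i z => pointPotential (average f)
            (innerStep f τ₁ τ₂ w (fullGradient f w).val i z).val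
          + c (j + 1) * sqDist (innerStep f τ₁ τ₂ w (fullGradient f w).val i z).val w)
      change 𝔼 s : Fin N → Fin n × Fin n, (pointPotential (average f) (innerStep f τ₁ τ₂ w
        (fullGradient f w).val (s j) (Z s j j.is_lt.le)).val + c (j + 1) * sqDist (innerStep f τ₁ τ₂
        w (fullGradient f w).val (s j) (Z s j j.is_lt.le)).val w) + _ ≤ _
      rw [hres, Finset.mul_expect, ← Finset.expect_add_distrib]
      refine Finset.expect_le_expect fun s _ => ?_
      have h1 := hstep (Z s j j.is_lt.le)
      have h2 := mul_le_mul_of_nonneg_right hrec (sqDist_nonneg (Z s j j.is_lt.le) w)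
      linarith
  have h0 : 𝔼 s : Fin N → Fin n × Fin n, (pointPotential (average f) (Z s 0 (Nat.zero_le N))
      + c 0 * sqDist (Z s 0 (Nat.zero_le N)) w) = pointPotential (average f) w := by
    have : ∀ s : Fin N → Fin n × Fin n, Z s 0 (Nat.zero_le N) = w := fun s => rfl
    simp only [this, sqDist_self, mul_zero, add_zero]
    exact Fintype.expect_const _
  rw [h0] at key
  refine le_trans (add_le_add_left (Finset.expect_le_expect fun s _ => ?_) _) key
  have : 0 ≤ c N * sqDist (Z s N le_rfl) w := by
    refine mul_nonneg ?_ (sqDist_nonneg _ _)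
    simp only [c]
    have : (0 : ℝ) ≤ 2 * N - N := by linarith
    positivity
  linarith

/-- One epoch halves the potential if the passes are long enough. -/
theorem expect_epoch_le (hO : HasOptima (average f)) (hn : 1 ≤ n) (hN : 1 ≤ N) (hT : 1 ≤ T)
    (hρ : 2 ≤ ρ * (T * N))
    (hpass : ∀ w : Vec d₁ × Vec d₂, 𝔼 s : Fin N → Fin n × Fin n,
        pointPotential (average f) (innerLoop f τ₁ τ₂ w (fullGradient f w).val s N le_rfl).val
      + ∑ j : Fin N, ρ * 𝔼 s : Fin N → Fin n × Fin n, pointPotential (average f)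
          (innerLoop f τ₁ τ₂ w (fullGradient f w).val s j j.is_lt.le).val
      ≤ pointPotential (average f) w) (z₀ : Vec d₁ × Vec d₂) :
    𝔼 seed : Seed n N T, pointPotential (average f) (epoch f τ₁ τ₂ seed z₀).val
      ≤ 1 / 2 * pointPotential (average f) z₀ := by
  have : Nonempty (Fin n) := ⟨⟨0, hn⟩⟩
  let W : (s : Fin T → Fin N → Fin n × Fin n) → (t : ℕ) → t ≤ T → Vec d₁ × Vec d₂ :=
    fun s t h => (outerLoop f τ₁ τ₂ s z₀ t h).val
  let X : Vec d₁ × Vec d₂ → (Fin N → Fin n × Fin n) → (j : ℕ) → j ≤ N → Vec d₁ × Vec d₂ :=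
    fun w r j h => (innerLoop f τ₁ τ₂ w (fullGradient f w).val r j h).val
  have key := add_sum_le_of_step (fun t h => 𝔼 s, pointPotential (average f) (W s t h))
    (fun t => ∑ j : Fin N, ρ * 𝔼 s : Fin T → Fin N → Fin n × Fin n,
      pointPotential (average f) (iterate f τ₁ τ₂ s z₀ t j)) fun t => by
      have hres := fun Ψ => expect_resample (I := Fin N → Fin n × Fin n) t
        (fun s => W s t t.is_lt.le)
        (fun s r => congrArg Counted.val (outerLoop_update s z₀ t r t t.is_lt.le le_rfl)) Ψ
      have h1 := hres fun r w => pointPotential (average f) (X w r N le_rfl)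
      have h2 := fun j : Fin N => hres fun r w => pointPotential (average f) (X w r j j.is_lt.le)
      change 𝔼 s : Fin T → Fin N → Fin n × Fin n,
          pointPotential (average f) (X (W s t t.is_lt.le) (s t) N le_rfl)
        + ∑ j : Fin N, ρ * 𝔼 s : Fin T → Fin N → Fin n × Fin n,
          pointPotential (average f) (X (W s t t.is_lt.le) (s t) j j.is_lt.le) ≤ _
      rw [h1]
      simp only [h2, Finset.mul_expect]
      rw [← Finset.expect_sum_comm, ← Finset.expect_add_distrib]
      refine Finset.expect_le_expect fun s _ => ?_
      have h3 := hpass (W s t t.is_lt.le)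
      simp only [Finset.mul_expect] at h3
      exact h3
  have h0 : 𝔼 s : Fin T → Fin N → Fin n × Fin n, pointPotential (average f)
      (W s 0 (Nat.zero_le T)) = pointPotential (average f) z₀ := by
    have : ∀ s : Fin T → Fin N → Fin n × Fin n, W s 0 (Nat.zero_le T) = z₀ := fun s => rfl
    simp only [this]
    exact Fintype.expect_const _
  rw [h0] at key
  have hend : 0 ≤ 𝔼 s : Fin T → Fin N → Fin n × Fin n,
      pointPotential (average f) (W s T le_rfl) :=
    Finset.expect_nonneg fun s _ => hO.pointPotential_nonneg _
  -- The position is uniform and independent of the indices, so the expectation is the mean over all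
  -- TN iterates.
  have hmean : 𝔼 seed : Seed n N T, pointPotential (average f) (epoch f τ₁ τ₂ seed z₀).val
      = (∑ t : Fin T, ∑ j : Fin N, 𝔼 s : Fin T → Fin N → Fin n × Fin n,
        pointPotential (average f) (iterate f τ₁ τ₂ s z₀ t j)) / (T * N) := by
    rw [← Finset.univ_product_univ, Finset.expect_product, Finset.expect_comm,
      Fintype.expect_eq_sum_div_card, Fintype.sum_prod_type]
    simp [epoch]
  set S := ∑ t : Fin T, ∑ j : Fin N, 𝔼 s : Fin T → Fin N → Fin n × Fin n,
        pointPotential (average f) (iterate f τ₁ τ₂ s z₀ t j) with hS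
  have hsum : ∑ t : Fin T, ∑ j : Fin N, ρ * 𝔼 s : Fin T → Fin N → Fin n × Fin n,
        pointPotential (average f) (iterate f τ₁ τ₂ s z₀ t j) = ρ * S := by
    simp only [hS, Finset.mul_sum]
  rw [hsum] at key
  have hS0 : 0 ≤ S := Finset.sum_nonneg fun t _ => Finset.sum_nonneg fun j _ =>
    Finset.expect_nonneg fun s _ => hO.pointPotential_nonneg _
  have hTN : (0 : ℝ) < T * N := by
    have : (0 : ℝ) < T := by exact_mod_cast hT
    have : (0 : ℝ) < N := by exact_mod_cast hN
    positivity
  rw [hmean, div_le_iff₀ hTN]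
  have hT' := mul_le_mul_of_nonneg_right hρ hS0
  have hk := mul_le_mul_of_nonneg_right (by linarith : ρ * S ≤ pointPotential (average f) z₀)
    hTN.le
  linarith

end VRAGDA

/-! ### From finite averages to expectations over the seeds -/

namespace VRAGDA

open MeasureTheory ProbabilityTheory
open scoped BigOperators

section Randomness

variable {Ω : Type*} [MeasurableSpace Ω] {P : Measure Ω} {S : Type} [Fintype S]
  [MeasurableSpace S] {seed : ℕ → Ω → S}

/-- The first `k` seeds. -/
def firstSeeds (seed : ℕ → Ω → S) (k : ℕ) (ω : Ω) : Finset.range k → S := fun i => seed i ω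

theorem IsIIDUniform.measurable_firstSeeds (h : IsIIDUniform P seed) (k : ℕ) :
    Measurable (firstSeeds seed k) := measurable_pi_lambda _ fun i => h.measurable i

theorem IsIIDUniform.indepFun_firstSeeds (h : IsIIDUniform P seed) (k : ℕ) :
    IndepFun (firstSeeds seed k) (seed k) P := by
  have h1 := h.indep.indepFun_finset (Finset.range k) {k} (by simp) h.measurable
  exact h1.comp (φ := id)
    (ψ := fun a : ({k} : Finset ℕ) → S => a ⟨k, Finset.mem_singleton_self k⟩) measurable_id
    (measurable_pi_apply _)

variable [IsProbabilityMeasure P] [DiscreteMeasurableSpace S]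

/-- Finitely many seeds take finitely many values, so `F` needs neither regularity nor a growth
bound. -/
theorem IsIIDUniform.integrable_comp_firstSeeds (h : IsIIDUniform P seed) (k : ℕ)
    (F : (Finset.range k → S) → ℝ) : Integrable (fun ω => F (firstSeeds seed k ω)) P := by
  have := Measure.isProbabilityMeasure_map (μ := P) (h.measurable_firstSeeds k).aemeasurable
  exact (Integrable.of_finite (μ := P.map (firstSeeds seed k)) (f := F)).comp_measurable
    (h.measurable_firstSeeds k)

theorem IsIIDUniform.integral_seed (h : IsIIDUniform P seed) (k : ℕ) (F : S → ℝ) :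
    ∫ s, F s ∂(P.map (seed k)) = 𝔼 s, F s := by
  have := Measure.isProbabilityMeasure_map (μ := P) (h.measurable k).aemeasurable
  rw [integral_fintype Integrable.of_finite, Fintype.expect_eq_sum_div_card, Finset.sum_div]
  refine Finset.sum_congr rfl fun s _ => ?_
  have h1 : (P.map (seed k)).real {s} = ((Fintype.card S : ℕ) : ℝ)⁻¹ := by
    rw [measureReal_def, Measure.map_apply (h.measurable k) (measurableSet_singleton s)]
    have := h.uniform k s
    rw [Set.preimage]
    simp only [Set.mem_singleton_iff]
    rw [this, ENNReal.toReal_inv, ENNReal.toReal_natCast]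
  rw [h1, smul_eq_mul, div_eq_inv_mul]

/-- The seed `k` may be averaged out of a function of the first `k + 1` seeds. -/
theorem IsIIDUniform.integral_eq_integral_expect (h : IsIIDUniform P seed) (k : ℕ)
    (F : S → (Finset.range k → S) → ℝ) :
    ∫ ω, F (seed k ω) (firstSeeds seed k ω) ∂P = ∫ ω, 𝔼 s, F s (firstSeeds seed k ω) ∂P := by
  have hX := h.measurable_firstSeeds k
  have hY := h.measurable k
  have := Measure.isProbabilityMeasure_map (μ := P) hX.aemeasurable
  have := Measure.isProbabilityMeasure_map (μ := P) hY.aemeasurable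
  have hprod := (indepFun_iff_map_prod_eq_prod_map_map hX.aemeasurable hY.aemeasurable).1
    (h.indepFun_firstSeeds k)
  have hmeas : ∀ G : (Finset.range k → S) → ℝ, Measurable G := fun G => measurable_of_finite G
  calc ∫ ω, F (seed k ω) (firstSeeds seed k ω) ∂P
      = ∫ p, F p.2 p.1 ∂(P.map fun ω => (firstSeeds seed k ω, seed k ω)) :=
        (integral_map (hX.prodMk hY).aemeasurable (f := fun p => F p.2 p.1)
          (measurable_of_finite _).aestronglyMeasurable).symm
    _ = ∫ a, ∫ s, F s a ∂(P.map (seed k)) ∂(P.map (firstSeeds seed k)) := by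
        rw [hprod]
        exact integral_prod _ Integrable.of_finite
    _ = ∫ a, 𝔼 s, F s a ∂(P.map (firstSeeds seed k)) := by
        simp only [h.integral_seed]
    _ = _ := MeasureTheory.integral_map hX.aemeasurable (hmeas _).aestronglyMeasurable

end Randomness

variable {d₁ d₂ n N T : ℕ} {f : Fin n → Vec d₁ → Vec d₂ → ℝ} {τ₁ τ₂ : ℝ}

theorem run_congr {σ σ' : ℕ → Seed n N T} (z₀ : Vec d₁ × Vec d₂) {k : ℕ}
    (h : ∀ m < k, σ m = σ' m) : run f τ₁ τ₂ σ z₀ k = run f τ₁ τ₂ σ' z₀ k := by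
  induction k with
  | zero => rfl
  | succ k ih =>
    simp only [run, ih fun m hm => h m (Nat.lt_succ_of_lt hm), h k (Nat.lt_succ_self k)]

/-- The `k`-th point as a function of the first `k` seeds. -/
theorem exists_run_eq [Nonempty (Seed n N T)] {Ω : Type*} (seed : ℕ → Ω → Seed n N T)
    (z₀ : Vec d₁ × Vec d₂) (k : ℕ) : ∃ φ : (Finset.range k → Seed n N T) → Vec d₁ × Vec d₂,
      ∀ ω, (run f τ₁ τ₂ (fun m => seed m ω) z₀ k).val = φ (firstSeeds seed k ω) := by
  classical
  -- Seeds with index at least k are never read, so any value may fill them.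
  refine ⟨fun a => (run f τ₁ τ₂
    (fun m => if h : m ∈ Finset.range k then a ⟨m, h⟩ else Classical.arbitrary _) z₀ k).val,
    fun ω => congrArg Counted.val (run_congr z₀ fun m hm => ?_)⟩
  rw [dif_pos (Finset.mem_range.2 hm)]
  rfl

section Potential

variable {Ω : Type*} [MeasurableSpace Ω] {P : Measure Ω} [IsProbabilityMeasure P]
  [Nonempty (Seed n N T)] {seed : ℕ → Ω → Seed n N T} {z₀ : Vec d₁ × Vec d₂}
  {z : ℕ → Ω → Vec d₁ × Vec d₂}

theorem IsIIDUniform.integrable_run (h : IsIIDUniform P seed)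
    (hz : ∀ k ω, z k ω = (run f τ₁ τ₂ (fun m => seed m ω) z₀ k).val) (k : ℕ)
    (F : Vec d₁ × Vec d₂ → ℝ) : Integrable (fun ω => F (z k ω)) P := by
  obtain ⟨φ, hφ⟩ := exists_run_eq (f := f) (τ₁ := τ₁) (τ₂ := τ₂) seed z₀ k
  simp only [hz, hφ]
  exact h.integrable_comp_firstSeeds k fun a => F (φ a)

theorem IsIIDUniform.potential_eq (h : IsIIDUniform P seed)
    (hz : ∀ k ω, z k ω = (run f τ₁ τ₂ (fun m => seed m ω) z₀ k).val) (F : Vec d₁ → Vec d₂ → ℝ)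
    (k : ℕ) : potential F P (z k) = ∫ ω, pointPotential F (z k ω) ∂P := by
  unfold potential pointPotential
  rw [integral_add (h.integrable_run hz k fun w => primal F w.1 - primalValue F)
    (h.integrable_run hz k fun w => 1 / 20 * (primal F w.1 - F w.1 w.2)), integral_const_mul]

theorem IsIIDUniform.potential_succ_le (h : IsIIDUniform P seed)
    (hz : ∀ k ω, z k ω = (run f τ₁ τ₂ (fun m => seed m ω) z₀ k).val) {F : Vec d₁ → Vec d₂ → ℝ}
    (hepoch : ∀ w, 𝔼 σ : Seed n N T, pointPotential F (epoch f τ₁ τ₂ σ w).val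
      ≤ 1 / 2 * pointPotential F w) (k : ℕ) :
    potential F P (z (k + 1)) ≤ 1 / 2 * potential F P (z k) := by
  rw [h.potential_eq hz, h.potential_eq hz, ← integral_const_mul]
  obtain ⟨φ, hφ⟩ := exists_run_eq (f := f) (τ₁ := τ₁) (τ₂ := τ₂) seed z₀ k
  have h1 : ∀ ω, z (k + 1) ω = (epoch f τ₁ τ₂ (seed k ω) (φ (firstSeeds seed k ω))).val :=
    fun ω => by rw [hz, ← hφ]; rfl
  have h2 : ∀ ω, z k ω = φ (firstSeeds seed k ω) := fun ω => by rw [hz, hφ]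
  simp only [h1, h2]
  rw [h.integral_eq_integral_expect k
    fun σ a => pointPotential F (epoch f τ₁ τ₂ σ (φ a)).val]
  exact integral_mono
    (h.integrable_comp_firstSeeds k fun a =>
      𝔼 σ, pointPotential F (epoch f τ₁ τ₂ σ (φ a)).val)
    (h.integrable_comp_firstSeeds k fun a => 1 / 2 * pointPotential F (φ a))
    fun ω => hepoch _

end Potential

/-! ### Number of epochs and lengths of the loops -/

/-- The number of halvings until `ε` is reached. -/
theorem exists_le_of_halving {p : ℕ → ℝ} (h0 : 0 ≤ p 0) (hp : ∀ k, p (k + 1) ≤ 1 / 2 * p k)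
    {ε : ℝ} (hε : 0 < ε) (hε' : ε ≤ 1 / 2) : ∃ K : ℕ, (∀ k, K ≤ k → p k ≤ ε) ∧
      (K : ℝ) ≤ 4 * (Real.log (1 / ε) + max 0 (Real.log (p 0))) := by
  set L := Real.log (1 / ε) + max 0 (Real.log (p 0)) with hL
  have hlog2 : 1 / 2 < Real.log 2 := by linarith [Real.log_two_gt_d9]
  have hlogε : Real.log 2 ≤ Real.log (1 / ε) :=
    Real.log_le_log (by norm_num) (by rw [le_div_iff₀ hε]; linarith)
  have hL2 : Real.log 2 ≤ L := hlogε.trans (le_add_of_nonneg_right (le_max_left _ _))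
  have hLpos : 0 < L := by linarith
  have hgeom : ∀ k, p k ≤ (1 / 2) ^ k * p 0 := fun k => by
    induction k with
    | zero => simp
    | succ k ih => rw [pow_succ']; linarith [hp k]
  refine ⟨⌈L / Real.log 2⌉₊, fun k hk => ?_, ?_⟩
  · have hkL : L ≤ k * Real.log 2 := by
      rw [← div_le_iff₀ (by linarith)]
      exact (Nat.le_ceil _).trans (by exact_mod_cast hk)
    have h1 : p 0 ≤ Real.exp (max 0 (Real.log (p 0))) := by
      rcases h0.eq_or_lt with h | h
      · rw [← h]; positivity
      · calc p 0 = Real.exp (Real.log (p 0)) := (Real.exp_log h).symm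
          _ ≤ _ := Real.exp_le_exp.2 (le_max_right _ _)
    have h2 : 1 / ε * p 0 ≤ 2 ^ k := by
      calc 1 / ε * p 0 ≤ 1 / ε * Real.exp (max 0 (Real.log (p 0))) := by gcongr
        _ = Real.exp L := by rw [hL, Real.exp_add, Real.exp_log (by positivity)]
        _ ≤ Real.exp (k * Real.log 2) := Real.exp_le_exp.2 hkL
        _ = 2 ^ k := by rw [Real.exp_nat_mul, Real.exp_log (by norm_num)]
    refine (hgeom k).trans ?_
    rw [one_div_mul_eq_div, div_le_iff₀ hε] at h2
    rw [one_div, inv_pow, inv_mul_le_iff₀ (by positivity)]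
    exact h2
  -- The ceiling is at most 2L + 1, and 1 ≤ 2L because ε ≤ 1/2 forces L ≥ log 2 > 1/2.
  · have h1 := (Nat.ceil_lt_add_one (by positivity : 0 ≤ L / Real.log 2)).le
    have h2 : L / Real.log 2 ≤ 2 * L := by
      rw [div_le_iff₀ (by linarith)]
      nlinarith
    linarith

/-- The bounds on the lengths of the loops for the constants `β = 10⁻¹⁰` and `α = 1500 β^(-1/3)`,
in terms of `s = n^(1/3)`. -/
theorem loop_lengths {n : ℕ} {κ α β : ℝ} (hn : 1 ≤ n) (hκ : 1 ≤ κ) (hnκ : (n : ℝ) ≤ κ ^ 9)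
    (hβ : β = 1 / 10 ^ 10) (hα : α = 1500 * β ^ (-(1 / 3) : ℝ)) {N T : ℕ}
    (hN : N = ⌊α * β ^ (-(2 / 3) : ℝ) * (n : ℝ)
      * (2 + 4 * β ^ (1 / 2 : ℝ) * (n : ℝ) ^ (-(1 / 3) : ℝ))⁻¹⌋₊)
    (hT : T = ⌈κ ^ 3 * (n : ℝ) ^ (-(1 / 3) : ℝ)⌉₊) :
    ∃ s : ℝ, 1 ≤ s ∧ s ^ 3 = n ∧ (n : ℝ) ^ (2 / 3 : ℝ) = s ^ 2 ∧ 224 * s ^ 3 ≤ β * N ∧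
      β * N ≤ 750 * s ^ 3 ∧ κ ^ 3 ≤ T * s ∧ T * s ≤ 2 * κ ^ 3 := by
  have hn' : (1 : ℝ) ≤ n := by exact_mod_cast hn
  have hn0 : (0 : ℝ) ≤ n := by linarith
  have hβ0 : 0 < β := by rw [hβ]; positivity
  set s : ℝ := (n : ℝ) ^ (1 / 3 : ℝ) with hs
  have hs1 : 1 ≤ s := Real.one_le_rpow hn' (by norm_num)
  have hs0 : 0 < s := by linarith
  have hs3 : s ^ 3 = n := by
    rw [hs, ← Real.rpow_natCast, ← Real.rpow_mul hn0]
    norm_num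
  have hs2 : (n : ℝ) ^ (2 / 3 : ℝ) = s ^ 2 := by
    rw [hs, ← Real.rpow_natCast, ← Real.rpow_mul hn0]
    norm_num
  have hsinv : (n : ℝ) ^ (-(1 / 3) : ℝ) = s⁻¹ := Real.rpow_neg hn0 _
  have hαβ : α * β ^ (-(2 / 3) : ℝ) = 1500 / β := by
    rw [hα, mul_assoc, ← Real.rpow_add hβ0]
    norm_num [Real.rpow_neg_one, div_eq_mul_inv]
  have hsqrt : β ^ (1 / 2 : ℝ) = 1 / 10 ^ 5 := by
    rw [← Real.sqrt_eq_rpow, hβ, show (1 : ℝ) / 10 ^ 10 = (1 / 10 ^ 5) ^ 2 by norm_num,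
      Real.sqrt_sq (by norm_num)]
  rw [hsinv, hαβ, hsqrt, ← hs3] at hN
  rw [hsinv] at hT
  have hden1 : 2 ≤ 2 + 4 * (1 / 10 ^ 5) * s⁻¹ := le_add_of_nonneg_right (by positivity)
  have hden2 : 2 + 4 * (1 / 10 ^ 5) * s⁻¹ ≤ 3 := by
    have := inv_le_one_of_one_le₀ hs1
    linarith
  set D := 2 + 4 * (1 / 10 ^ 5) * s⁻¹
  have hD0 : 0 < D := by linarith
  have hs31 : 1 ≤ s ^ 3 := one_le_pow₀ hs1
  have hx : β * (1500 / β * s ^ 3 * D⁻¹) = 1500 * s ^ 3 / D := by field_simp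
  have hx1 : 500 * s ^ 3 ≤ 1500 * s ^ 3 / D := by
    rw [le_div_iff₀ hD0]
    nlinarith
  have hx2 : 1500 * s ^ 3 / D ≤ 750 * s ^ 3 := by
    rw [div_le_iff₀ hD0]
    nlinarith
  -- This is where n ≤ κ⁹ enters: rounding T up then costs at most a factor 2.
  have hsκ : s ≤ κ ^ 3 := by
    refine le_of_pow_le_pow_left₀ (n := 3) (by norm_num) (by positivity) ?_
    rw [hs3, ← pow_mul]
    exact hnκ
  refine ⟨s, hs1, hs3, hs2, ?_, ?_, ?_, ?_⟩
  · have h1 := (Nat.lt_floor_add_one (1500 / β * s ^ 3 * D⁻¹)).le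
    rw [← hN] at h1
    have h2 := mul_le_mul_of_nonneg_left h1 hβ0.le
    rw [hx] at h2
    have : β ≤ 1 := by rw [hβ]; norm_num
    linarith
  · have h1 := Nat.floor_le (by positivity : 0 ≤ 1500 / β * s ^ 3 * D⁻¹)
    rw [← hN] at h1
    have h2 := mul_le_mul_of_nonneg_left h1 hβ0.le
    rw [hx] at h2
    linarith
  · have h1 := Nat.le_ceil (κ ^ 3 * s⁻¹)
    rw [← hT, ← div_eq_mul_inv, div_le_iff₀ hs0] at h1
    exact h1
  · have h1 := (Nat.ceil_lt_add_one (by positivity : 0 ≤ κ ^ 3 * s⁻¹)).le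
    rw [← hT] at h1
    have h2 := mul_le_mul_of_nonneg_right h1 hs0.le
    have h3 : (κ ^ 3 * s⁻¹ + 1) * s = κ ^ 3 + s := by field_simp
    linarith

end VRAGDA

/-! ### Choice of the constants and conclusion -/

open MeasureTheory VRAGDA in
theorem theorem5 :
    -- absolute constants: they depend on no other datum, not even on the dimensions
    ∃ α β C : ℝ, 0 < α ∧ 0 < β ∧ 0 < C ∧
      ∀ (d₁ d₂ n : ℕ) (f : Fin n → Vec d₁ → Vec d₂ → ℝ) (l μ₁ μ₂ κ : ℝ),
        1 ≤ n → 0 < l → 0 < μ₁ → 0 < μ₂ → κ = l / min μ₁ μ₂ →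
        (∀ i, HasLipschitzGradients (f i) l) →
        HasOptima (average f) →
        TwoSidedPL (average f) μ₁ μ₂ →
        (n : ℝ) ≤ κ ^ 9 →
        ∀ (τ₁ τ₂ : ℝ) (N T : ℕ),
          τ₁ = β / (28 * κ ^ 2 * l * (n : ℝ) ^ (2 / 3 : ℝ)) →
          τ₂ = β / (l * (n : ℝ) ^ (2 / 3 : ℝ)) →
          N = ⌊α * β ^ (-(2 / 3) : ℝ) * (n : ℝ)
                * (2 + 4 * β ^ (1 / 2 : ℝ) * (n : ℝ) ^ (-(1 / 3) : ℝ))⁻¹⌋₊ →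
          T = ⌈κ ^ 3 * (n : ℝ) ^ (-(1 / 3) : ℝ)⌉₊ →
          -- the inner and the outer loop are not empty
          1 ≤ N ∧ 1 ≤ T ∧
          ∀ (Ω : Type*) [MeasurableSpace Ω] (P : Measure Ω) [IsProbabilityMeasure P]
            (seed : ℕ → Ω → Seed n N T), IsIIDUniform P seed →
            ∀ (z₀ : Vec d₁ × Vec d₂) (z : ℕ → Ω → Vec d₁ × Vec d₂) (Pot : ℕ → ℝ),
              (∀ k ω, z k ω = (run f τ₁ τ₂ (fun m => seed m ω) z₀ k).val) →
              (∀ k, Pot k = potential (average f) P (z k)) →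
              -- the expectations in the potential exist
              (∀ k, Integrable
                  (fun ω => primal (average f) (z k ω).1 - primalValue (average f)) P ∧
                Integrable
                  (fun ω => primal (average f) (z k ω).1 - average f (z k ω).1 (z k ω).2) P) ∧
              -- every epoch halves the potential
              (∀ k, Pot (k + 1) ≤ (1 / 2) * Pot k) ∧
              -- number of component gradients evaluated until the potential is at most `ε`
              (∀ ε : ℝ, 0 < ε → ε ≤ 1 / 2 →
                ∃ K : ℕ, (∀ k, K ≤ k → Pot k ≤ ε) ∧
                  ∀ ω, ((run f τ₁ τ₂ (fun m => seed m ω) z₀ K).calls : ℝ)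
                    ≤ C * ((n : ℝ) ^ (2 / 3 : ℝ) * κ ^ 3
                        * (Real.log (1 / ε) + max 0 (Real.log (Pot 0))))) := by
  obtain ⟨β, hβ⟩ : ∃ β : ℝ, β = 1 / 10 ^ 10 := ⟨_, rfl⟩
  have hβ0 : 0 < β := by rw [hβ]; positivity
  -- α makes αβ^{-2/3} = 1500/β, so N is of order n/β, while β is small enough for η³N² ≤ 750²β ≤
  -- 10⁻⁴. In C, 8 = 4 · 2 combines the bound on K with Ts ≤ 2κ³, and the other factor bounds (2n +
  -- 4N)/n.
  refine ⟨1500 * β ^ (-(1 / 3) : ℝ), β, 8 * (2 + 3000 / β), by positivity, hβ0, by positivity, ?_⟩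
  intro d₁ d₂ n f l μ₁ μ₂ κ hn hl hμ₁ hμ₂ hκ hf hO hPL hnκ τ₁ τ₂ N T hτ₁ hτ₂ hN hT
  obtain ⟨μ, hμ⟩ : ∃ μ, μ = min μ₁ μ₂ := ⟨_, rfl⟩
  rw [← hμ] at hκ
  have hμ0 : 0 < μ := hμ ▸ lt_min hμ₁ hμ₂
  have hPL' : TwoSidedPL (average f) μ μ :=
    hPL.mono hO (hμ ▸ min_le_left _ _) (hμ ▸ min_le_right _ _)
  have hlκ : l = κ * μ := by rw [hκ]; field_simp
  have hκ0 : 0 < κ := by rw [hκ]; positivity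
  have hn' : (1 : ℝ) ≤ n := by exact_mod_cast hn
  -- κ ≥ 1 is not assumed; it follows from 1 ≤ n ≤ κ⁹.
  have hκ1 : 1 ≤ κ := (one_le_pow_iff_of_nonneg hκ0.le (by norm_num)).1 (hn'.trans hnκ)
  obtain ⟨s, hs1, hs3, hs2, hN1, hN2, hT1, hT2⟩ := loop_lengths hn hκ1 hnκ hβ rfl hN hT
  have hs0 : 0 < s := by linarith
  have hNpos : 1 ≤ N := by
    by_contra! h
    rw [Nat.lt_one_iff.1 h] at hN1
    have : 0 < s ^ 3 := by positivity
    norm_num at hN1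
    linarith
  have hTpos : 1 ≤ T := by
    by_contra! h
    rw [Nat.lt_one_iff.1 h] at hT1
    have : 0 < κ ^ 3 := by positivity
    norm_num at hT1
    linarith
  refine ⟨hNpos, hTpos, ?_⟩
  rw [hs2] at hτ₁ hτ₂
  set η := β / s ^ 2 with hη
  have hη0 : 0 < η := by positivity
  have hη1 : η ≤ 1 / 50 := by
    have : η ≤ β := div_le_self hβ0.le (one_le_pow₀ hs1)
    rw [hβ] at this
    linarith
  have hτ₂l : τ₂ * l = η := by rw [hτ₂, hη]; field_simp
  have hτ₂₁ : τ₂ = 28 * κ ^ 2 * τ₁ := by rw [hτ₂, hτ₁]; field_simp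
  have hηN : η ^ 3 * (N : ℝ) ^ 2 ≤ 1 / 10000 := by
    have h1 : (β * N) ^ 2 ≤ (750 * s ^ 3) ^ 2 := by gcongr
    calc η ^ 3 * (N : ℝ) ^ 2 = β / (s ^ 6) * (β * N) ^ 2 := by rw [hη]; field_simp
      _ ≤ β / (s ^ 6) * (750 * s ^ 3) ^ 2 := by gcongr
      _ = β * 750 ^ 2 := by field_simp
      _ ≤ 1 / 10000 := by rw [hβ]; norm_num
  have hρ : 2 ≤ τ₁ * μ / 4 * (T * N) := by
    -- 224 = 2 · 4 · 28: the target 2, the rate 1/4 and the stepsize ratio 28.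
    have h1 : 224 * s ^ 3 * κ ^ 3 ≤ β * N * (T * s) := by gcongr
    have h2 : τ₁ * μ / 4 * (T * N) = β * N * (T * s) / (112 * κ ^ 3 * s ^ 3) := by
      rw [hτ₁, hlκ]; field_simp; ring
    rw [h2, le_div_iff₀ (by positivity)]
    linarith
  have hepoch := expect_epoch_le hO hn hNpos hTpos hρ
    (expect_innerLoop_le hn hf hO hPL' hμ0 hκ1 hlκ hη0 hη1 hτ₂l hτ₂₁ hNpos hηN)
  intro Ω _ P _ seed hseed z₀ z Pot hz hPot
  have : Nonempty (Seed n N T) :=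
    ⟨(fun _ _ => (⟨0, hn⟩, ⟨0, hn⟩), (⟨0, hTpos⟩, ⟨0, hNpos⟩))⟩
  have hstep : ∀ k, Pot (k + 1) ≤ 1 / 2 * Pot k := fun k => by
    rw [hPot, hPot]
    exact hseed.potential_succ_le hz hepoch k
  refine ⟨fun k => ⟨hseed.integrable_run hz k
      fun w => primal (average f) w.1 - primalValue (average f),
    hseed.integrable_run hz k fun w => primal (average f) w.1 - average f w.1 w.2⟩,
    hstep, fun ε hε hε' => ?_⟩
  have hPot0 : 0 ≤ Pot 0 := by
    rw [hPot, hseed.potential_eq hz]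
    exact integral_nonneg fun ω => hO.pointPotential_nonneg _
  obtain ⟨K, hK, hKle⟩ := exists_le_of_halving hPot0 hstep hε hε'
  refine ⟨K, hK, fun ω => ?_⟩
  rw [run_calls, hs2]
  set L := Real.log (1 / ε) + max 0 (Real.log (Pot 0))
  have hcost : 2 * (n : ℝ) + 4 * N ≤ (2 + 3000 / β) * s ^ 3 := by
    have : (N : ℝ) ≤ 750 * s ^ 3 / β := by
      rw [le_div_iff₀ hβ0]; linarith
    rw [← hs3]
    calc 2 * s ^ 3 + 4 * (N : ℝ) ≤ 2 * s ^ 3 + 4 * (750 * s ^ 3 / β) := by gcongr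
      _ = (2 + 3000 / β) * s ^ 3 := by ring
  have hL0 : 0 ≤ L := by
    have : (0 : ℝ) ≤ K := Nat.cast_nonneg K
    linarith
  push_cast
  calc (K : ℝ) * (T * (2 * n + 4 * N)) ≤ (4 * L) * (T * ((2 + 3000 / β) * s ^ 3)) := by gcongr
    _ = 4 * L * (2 + 3000 / β) * s ^ 2 * (T * s) := by ring
    _ ≤ 4 * L * (2 + 3000 / β) * s ^ 2 * (2 * κ ^ 3) := by gcongr
    _ = _ := by ring
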